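/- Let $g\ge 0$ be an integer, let $\mathbf b_0<\mathbf a_1<\mathbf b_1<\mathbf a_2<\dots<\mathbf a_g<\mathbf b_g<\mathbf a_0$ be real numbers (for $g=0$: $\mathbf b_0<\mathbf a_0$), and let $E=[\mathbf b_0,\mathbf a_0]\setminus\bigcup_{j=1}^g(\mathbf a_j,\mathbf b_j)$, regarded as a subset of $\mathbb C$. Let $\Psi$ be the Ahlfors function of $\overline{\mathbb C}\setminus E$, that is, a function that maximizes $\big|\lim_{z\to\infty}zf(z)\big|$ among all analytic functions $f$ on $\overline{\mathbb C}\setminus E$ with $f(\infty)=0$ and $|f|\le 1$, normalized by $\lim_{z\to\infty}z\Psi(z)>0$. (Such a function exists.) Then the function $$\Delta_E(z):=\Psi(z)+\frac1{\Psi(z)},\qquad z\in\overline{\mathbb C}\setminus E,$$ with value $\infty$ where $\Psi(z)=0$, is (the restriction of) a rational function of the form $$\Delta_E(z)=\lambda_0z+\mathbf c_0+\sum_{j=1}^g\frac{\lambda_j}{\mathbf c_j-z},$$ where $\lambda_j>0$ for $0\le j\le g$, $\mathbf c_0\in\mathbb R$, and $\mathbf c_j\in(\mathbf a_j,\mathbf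 b_j)$ for $1\le j\le g$. This rational function satisfies $$\Delta_E^{-1}([-2,2])=E,$$ it satisfies $\operatorname{Im}\Delta_E(z)>0$ for $\operatorname{Im}z>0$ and $\lim_{z\to\infty}\Delta_E(z)=\infty$, and it is the only one: if $R$ is a complex rational function with $\operatorname{Im}R(z)>0$ whenever $\operatorname{Im}z>0$ and $z$ is not a pole of $R$, with $\lim_{z\to\infty}R(z)=\infty$ and with $R^{-1}([-2,2])=E$, then $R=\Delta_E$. -/

import Mathlib

open Filter Topology

noncomputable section

namespace FiniteGap

/-- The endpoints `a 0, …, a g` and `b 0, …, b g` are those of a finite gap set: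
`b 0 < a 1 < b 1 < a 2 < ⋯ < a g < b g < a 0`. -/
structure IsGapData {g : ℕ} (a b : Fin (g + 1) → ℝ) : Prop where
  lt_left : ∀ j : Fin g, b j.castSucc < a j.succ
  lt_right : ∀ j : Fin g, a j.succ < b j.succ
  lt_last : b (Fin.last g) < a 0

/-- The finite gap set `[b 0, a 0] \ ⋃ j = 1, …, g, (a j, b j)`, as a subset of the complex
plane. -/
def gapSet {g : ℕ} (a b : Fin (g + 1) → ℝ) : Set ℂ :=
  Complex.ofReal '' (Set.Icc (b 0) (a 0) \ ⋃ j : Fin g, Set.Ioo (a j.succ) (b j.succ))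

/-- The competitors in the extremal problem of analytic capacity: functions that are analytic on
the complement of `E`, bounded by one in modulus there, and vanish at infinity. -/
structure IsCompetitor (E : Set ℂ) (f : ℂ → ℂ) : Prop where
  differentiableOn : DifferentiableOn ℂ f Eᶜ
  norm_le_one : ∀ z ∈ Eᶜ, ‖f z‖ ≤ 1
  tendsto_zero : Tendsto f (cocompact ℂ) (𝓝 0)

/-- `Ψ` is the Ahlfors function of the complement of `E` in the Riemann sphere: it maximizes
`|lim z f(z)|` (limit at infinity) among all competitors `f`, and it is normalized by
`lim z Ψ(z) > 0`. -/
def IsAhlfors (E : Set ℂ) (Ψ : ℂ → ℂ) : Prop :=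
  IsCompetitor E Ψ ∧
    ∃ γ : ℝ, 0 < γ ∧ Tendsto (fun z => z * Ψ z) (cocompact ℂ) (𝓝 (γ : ℂ)) ∧
      ∀ f : ℂ → ℂ, IsCompetitor E f →
        ∀ l : ℂ, Tendsto (fun z => z * f z) (cocompact ℂ) (𝓝 l) → ‖l‖ ≤ γ

/-- The value of a rational function at a point of the plane, in the Riemann sphere: the value
at a pole is `∞`. -/
def sphereEval (R : RatFunc ℂ) (z : ℂ) : OnePoint ℂ :=
  open Classical in
  if R.denom.eval z = 0 then OnePoint.infty else ((R.eval (RingHom.id ℂ) z : ℂ) : OnePoint ℂ)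

/-- The Joukowski map `w ↦ w + 1 / w` with values in the Riemann sphere, `0 ↦ ∞`. -/
def joukowski (w : ℂ) : OnePoint ℂ :=
  open Classical in
  if w = 0 then OnePoint.infty else ((w + 1 / w : ℂ) : OnePoint ℂ)

/-- The preimage of the real interval `[-2, 2]` under a rational function. -/
def bandPreimage (R : RatFunc ℂ) : Set ℂ :=
  {z : ℂ | ∃ x : ℝ, x ∈ Set.Icc (-2 : ℝ) 2 ∧ sphereEval R z = (((x : ℝ) : ℂ) : OnePoint ℂ)}

/-- `Im R(z) > 0` for `Im z > 0`, wherever `R(z)` is finite. -/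
def IsHerglotz (R : RatFunc ℂ) : Prop :=
  ∀ z : ℂ, 0 < z.im → R.denom.eval z ≠ 0 → 0 < (R.eval (RingHom.id ℂ) z).im

/-- `R(z) → ∞` as `z → ∞`. -/
def HasPoleAtInfinity (R : RatFunc ℂ) : Prop :=
  Tendsto (fun z => R.eval (RingHom.id ℂ) z) (cocompact ℂ) (cocompact ℂ)

end FiniteGap

end

open Filter Topology

noncomputable section

namespace FiniteGap

/-! ### Order of the endpoints, sign criterion and length of the gap set -/

section Order

variable {g : ℕ} {a b : Fin (g + 1) → ℝ}

/-! Put A = ∏ (z - a j), B = ∏ (z - b j), and let Λ = ∑ a j - ∑ b j, which is the length of E.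
Everything comes from explicit formulas: with s = √(B / A), Re s > 0, the Ahlfors function is Ψ = (s
- 1) / (s + 1), and Ψ + 1 / Ψ = 2 (s² + 1) / (s² - 1) = 2 (B + A) / (B - A), which is rational.

Properties of Δ = 2 (B + A) / (B - A). The polynomial B - A has degree g and leading coefficient Λ,
and each gap contains one of its zeros; Lagrange interpolation then gives the partial fractions with
positive coefficients (`exists_isPoleData`). Positivity makes Im Δ a positive multiple of Im z.
Together with Δ² - 4 = 16 A B / (B - A)², and since A B ≤ 0 on the real line exactly on E, this
gives the preimage of [-2, 2] (`bandPreimage_delta`). It also shows that B / A avoids (-∞, 0] off E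
(`ratio_mem_slitPlane`), so s is analytic there, |Ψ| ≤ 1, and z Ψ(z) → Λ / 4.

Extremality. The bound |lim z f(z)| ≤ |E| / 4 holds for every compact real set
(`norm_le_of_isCompetitor`). Make f symmetric under conjugation, map the disc to the strip |Im ζ| <
π / 2, and integrate along a horizontal line descending to the real axis. The imaginary part
contributes only over E, while the integral over the large arch yields π times the residue
(`pi_mul_le_of_abs_im_le`). Two extremal functions coincide (`extremal_unique`): their midpoint
leaves room for a perturbation by a multiple of the square of half their difference, which would
increase the residue.

Uniqueness of Δ. A Herglotz rational function takes real values on the real line only simply and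
increasingly (`herglotz_local`). Hence R - 2 vanishes exactly at the a j and R + 2 exactly at the b
j, all simply. As R has a pole at infinity, its numerator and denominator are then determined up to
a common factor (`eq_delta_of_bandPreimage`). -/

lemma IsGapData.strictMono_right (hab : IsGapData a b) : StrictMono b :=
  Fin.strictMono_iff_lt_succ.2 fun j => (hab.lt_left j).trans (hab.lt_right j)

lemma IsGapData.right_lt_left (hab : IsGapData a b) {i : Fin (g + 1)} {j : Fin g}
    (hij : i ≤ j.castSucc) : b i < a j.succ :=
  (hab.strictMono_right.monotone hij).trans_lt (hab.lt_left j)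

lemma IsGapData.right_lt_left_zero (hab : IsGapData a b) (j : Fin (g + 1)) : b j < a 0 :=
  (hab.strictMono_right.monotone (Fin.le_last j)).trans_lt hab.lt_last

lemma IsGapData.right_zero_lt_left (hab : IsGapData a b) (j : Fin (g + 1)) : b 0 < a j := by
  refine Fin.cases ?_ (fun j => ?_) j
  · exact hab.right_lt_left_zero 0
  · exact hab.right_lt_left (Fin.zero_le _)

lemma IsGapData.gap_separated (hab : IsGapData a b) {i j : Fin g} (hij : i ≠ j) :
    b i.succ < a j.succ ∨ b j.succ < a i.succ := by
  rcases lt_or_gt_of_ne hij with h | h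
  · exact Or.inl (hab.right_lt_left (Fin.succ_le_castSucc_iff.2 h))
  · exact Or.inr (hab.right_lt_left (Fin.succ_le_castSucc_iff.2 h))

lemma IsGapData.left_injective (hab : IsGapData a b) : Function.Injective a := by
  have h0 : ∀ j : Fin g, a j.succ < a 0 := fun j =>
    (hab.lt_right j).trans (hab.right_lt_left_zero _)
  intro i j
  refine Fin.cases ?_ (fun i => ?_) i <;> refine Fin.cases ?_ (fun j => ?_) j
  · simp
  · intro h; exact absurd h (h0 j).ne'
  · intro h; exact absurd h (h0 i).ne
  · intro h
    by_contra hne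
    have hij : i ≠ j := fun h' => hne (by rw [h'])
    rcases hab.gap_separated hij with h' | h'
    · linarith [hab.lt_right i]
    · linarith [hab.lt_right j]

/-- The finite gap set as a set of real numbers. -/
def realGapSet {g : ℕ} (a b : Fin (g + 1) → ℝ) : Set ℝ :=
  Set.Icc (b 0) (a 0) \ ⋃ j : Fin g, Set.Ioo (a j.succ) (b j.succ)

lemma gapSet_eq_image : gapSet a b = Complex.ofReal '' realGapSet a b := rfl

lemma ofReal_mem_gapSet {x : ℝ} : (x : ℂ) ∈ gapSet a b ↔ x ∈ realGapSet a b := by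
  rw [gapSet_eq_image]
  exact Complex.ofReal_injective.mem_set_image

lemma mem_gapSet {z : ℂ} : z ∈ gapSet a b ↔ z.im = 0 ∧ z.re ∈ realGapSet a b := by
  constructor
  · rintro ⟨x, hx, rfl⟩
    exact ⟨Complex.ofReal_im x, hx⟩
  · rintro ⟨h, hx⟩
    exact ⟨z.re, hx, Complex.ext rfl (by simp [h])⟩

lemma isCompact_realGapSet : IsCompact (realGapSet a b) :=
  isCompact_Icc.diff (isOpen_iUnion fun _ => isOpen_Ioo)

lemma isCompact_gapSet : IsCompact (gapSet a b) :=
  isCompact_realGapSet.image Complex.continuous_ofReal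

lemma prod_endpoints_eq (a b : Fin (g + 1) → ℝ) (x : ℝ) :
    (∏ j, (x - a j)) * ∏ j, (x - b j) =
      (x - b 0) * (x - a 0) * ∏ j : Fin g, ((x - a j.succ) * (x - b j.succ)) := by
  rw [Fin.prod_univ_succ, Fin.prod_univ_succ, Finset.prod_mul_distrib]
  ring

lemma prod_endpoints_nonpos (hab : IsGapData a b) {x : ℝ} (hx : x ∈ realGapSet a b) :
    (∏ j, (x - a j)) * ∏ j, (x - b j) ≤ 0 := by
  rw [prod_endpoints_eq]
  refine mul_nonpos_of_nonpos_of_nonneg ?_ (Finset.prod_nonneg fun j _ => ?_)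
  · exact mul_nonpos_of_nonneg_of_nonpos (sub_nonneg.2 hx.1.1) (sub_nonpos.2 hx.1.2)
  · have h : ¬ (a j.succ < x ∧ x < b j.succ) := fun h => hx.2 (Set.mem_iUnion.2 ⟨j, h⟩)
    have := hab.lt_right j
    rcases le_or_gt x (a j.succ) with h1 | h1
    · exact mul_nonneg_of_nonpos_of_nonpos (by linarith) (by linarith)
    · have h2 : b j.succ ≤ x := not_lt.1 fun h2 => h ⟨h1, h2⟩
      exact mul_nonneg (by linarith) (by linarith)

lemma gap_subset_Ioo (hab : IsGapData a b) (j : Fin g) {x : ℝ}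
    (hx : x ∈ Set.Ioo (a j.succ) (b j.succ)) : b 0 < x ∧ x < a 0 :=
  ⟨(hab.right_zero_lt_left _).trans hx.1, hx.2.trans (hab.right_lt_left_zero _)⟩

/-- Points of one gap are outside the closure of any other gap. -/
lemma gap_pair_same_side (hab : IsGapData a b) {i j : Fin g} (hij : i ≠ j) {x : ℝ}
    (hx : x ∈ Set.Ioo (a j.succ) (b j.succ)) : x < a i.succ ∨ b i.succ < x := by
  rcases hab.gap_separated hij with h | h
  · exact Or.inr (h.trans hx.1)
  · exact Or.inl (hx.2.trans h)

lemma prod_endpoints_pos (hab : IsGapData a b) {x : ℝ} (hx : x ∉ realGapSet a b) :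
    0 < (∏ j, (x - a j)) * ∏ j, (x - b j) := by
  rw [prod_endpoints_eq]
  by_cases h : ∃ j : Fin g, x ∈ Set.Ioo (a j.succ) (b j.succ)
  · obtain ⟨j, hj⟩ := h
    obtain ⟨h0, h1⟩ := gap_subset_Ioo hab j hj
    rw [← Finset.mul_prod_erase _ _ (Finset.mem_univ j), ← mul_assoc]
    refine mul_pos (mul_pos_of_neg_of_neg (mul_neg_of_pos_of_neg ?_ ?_)
      (mul_neg_of_pos_of_neg ?_ ?_)) (Finset.prod_pos fun i hi => ?_)
    · linarith
    · linarith
    · linarith [hj.1]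
    · linarith [hj.2]
    · have := hab.lt_right i
      rcases gap_pair_same_side hab (Finset.ne_of_mem_erase hi) hj with h | h
      · exact mul_pos_of_neg_of_neg (by linarith) (by linarith)
      · exact mul_pos (by linarith) (by linarith)
  · have hx' : x < b 0 ∨ a 0 < x := by
      by_contra! h'
      exact hx ⟨⟨h'.1, h'.2⟩, fun hU => h (Set.mem_iUnion.1 hU)⟩
    rcases hx' with hx' | hx'
    · refine mul_pos (mul_pos_of_neg_of_neg ?_ ?_) (Finset.prod_pos fun i _ =>
        mul_pos_of_neg_of_neg ?_ ?_)
      · linarith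
      · linarith [hab.right_zero_lt_left 0]
      · linarith [hab.right_zero_lt_left i.succ]
      · linarith [hab.right_zero_lt_left i.succ, hab.lt_right i]
    · refine mul_pos (mul_pos ?_ ?_) (Finset.prod_pos fun i _ => mul_pos ?_ ?_)
      · linarith [hab.right_zero_lt_left 0]
      · linarith
      · linarith [hab.right_lt_left_zero i.succ, hab.lt_right i]
      · linarith [hab.right_lt_left_zero i.succ]

/-- The same product A B appears in Δ² - 4, so this turns membership in E into a condition on Δ. -/
lemma mem_realGapSet_iff (hab : IsGapData a b) {x : ℝ} :
    x ∈ realGapSet a b ↔ (∏ j, (x - a j)) * ∏ j, (x - b j) ≤ 0 :=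
  ⟨prod_endpoints_nonpos hab, fun h => by
    by_contra hx
    exact absurd h (not_le.2 (prod_endpoints_pos hab hx))⟩

lemma left_mem_realGapSet (hab : IsGapData a b) (j : Fin (g + 1)) : a j ∈ realGapSet a b := by
  rw [mem_realGapSet_iff hab, Finset.prod_eq_zero (Finset.mem_univ j) (sub_self _), zero_mul]

lemma right_mem_realGapSet (hab : IsGapData a b) (j : Fin (g + 1)) : b j ∈ realGapSet a b := by
  rw [mem_realGapSet_iff hab,
    Finset.prod_eq_zero (f := fun i => b j - b i) (Finset.mem_univ j) (sub_self _), mul_zero]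

lemma left_ne_right (hab : IsGapData a b) (i j : Fin (g + 1)) : a i ≠ b j := by
  refine Fin.cases ?_ (fun i => ?_) i
  · exact (hab.right_lt_left_zero j).ne'
  · rcases le_or_gt j i.castSucc with h | h
    · exact (hab.right_lt_left h).ne'
    · exact ((hab.lt_right i).trans_le
        (hab.strictMono_right.monotone (Fin.castSucc_lt_iff_succ_le.1 h))).ne

/-- The total length of the finite gap set. -/
def totalLength {g : ℕ} (a b : Fin (g + 1) → ℝ) : ℝ := ∑ j, a j - ∑ j, b j

lemma totalLength_eq (a b : Fin (g + 1) → ℝ) :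
    totalLength a b = (a 0 - b 0) - ∑ j : Fin g, (b j.succ - a j.succ) := by
  rw [totalLength, Fin.sum_univ_succ, Fin.sum_univ_succ, Finset.sum_sub_distrib]
  ring

lemma totalLength_pos (hab : IsGapData a b) : 0 < totalLength a b := by
  have : totalLength a b =
      (a 0 - b (Fin.last g)) + ∑ j : Fin g, (a j.succ - b j.castSucc) := by
    rw [totalLength, Fin.sum_univ_succ a, Fin.sum_univ_castSucc b, Finset.sum_sub_distrib]
    ring
  rw [this]
  exact add_pos_of_pos_of_nonneg (sub_pos.2 hab.lt_last)
    (Finset.sum_nonneg fun j _ => (sub_pos.2 (hab.lt_left j)).le)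

lemma volume_realGapSet (hab : IsGapData a b) :
    MeasureTheory.volume.real (realGapSet a b) = totalLength a b := by
  have hsub : (⋃ j : Fin g, Set.Ioo (a j.succ) (b j.succ)) ⊆ Set.Icc (b 0) (a 0) := by
    refine Set.iUnion_subset fun j x hx => ?_
    obtain ⟨h0, h1⟩ := gap_subset_Ioo hab j hx
    exact ⟨h0.le, h1.le⟩
  have hmeas : MeasurableSet (⋃ j : Fin g, Set.Ioo (a j.succ) (b j.succ)) :=
    MeasurableSet.iUnion fun _ => measurableSet_Ioo
  have hdisj : Pairwise (Function.onFun Disjoint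
      fun j : Fin g => Set.Ioo (a j.succ) (b j.succ)) := by
    intro i j hij
    refine Set.disjoint_left.2 fun x hi hj => ?_
    rcases gap_pair_same_side hab hij hj with h | h
    · exact lt_asymm h hi.1
    · exact lt_asymm h hi.2
  rw [realGapSet, MeasureTheory.measureReal_sdiff hsub hmeas (by simp), Real.volume_real_Icc_of_le
    (hab.right_zero_lt_left 0).le, totalLength_eq,
    MeasureTheory.measureReal_def, MeasureTheory.measure_iUnion hdisj (fun _ => measurableSet_Ioo),
    tsum_fintype, ENNReal.toReal_sum (by simp)]
  congr 1
  exact Finset.sum_congr rfl fun j _ => Real.volume_real_Ioo_of_le (hab.lt_right j).le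

end Order

/-! ### Numerator, denominator and partial fractions of Δ -/

section RationalFunction

open Polynomial

variable {g : ℕ} {a b : Fin (g + 1) → ℝ}

/-- The monic real polynomial with the given roots. -/
abbrev rootPoly {n : ℕ} (a : Fin n → ℝ) : ℝ[X] := Lagrange.nodal Finset.univ a

lemma eval_rootPoly {n : ℕ} (a : Fin n → ℝ) (x : ℝ) :
    (rootPoly a).eval x = ∏ j, (x - a j) := Lagrange.eval_nodal

lemma natDegree_rootPoly {n : ℕ} (a : Fin n → ℝ) : (rootPoly a).natDegree = n := by
  simp [rootPoly, Lagrange.natDegree_nodal]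

lemma coeff_rootPoly_card {n : ℕ} (a : Fin n → ℝ) : (rootPoly a).coeff n = 1 := by
  have h : (rootPoly a).Monic := Lagrange.nodal_monic
  have := h.coeff_natDegree
  rwa [natDegree_rootPoly] at this

lemma coeff_rootPoly_pred {n : ℕ} (a : Fin (n + 1) → ℝ) :
    (rootPoly a).coeff n = -∑ j, a j := by
  have := prod_X_sub_C_coeff_card_pred Finset.univ a (by simp)
  simpa [rootPoly, Lagrange.nodal_eq] using this

/-- The polynomial `∏ (x - b j) - ∏ (x - a j)`, whose zeros are the finite poles of `Δ`. -/
def poleP {g : ℕ} (a b : Fin (g + 1) → ℝ) : ℝ[X] := rootPoly b - rootPoly a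

/-- The numerator `2 (∏ (x - b j) + ∏ (x - a j))` of `Δ`. -/
def numP {g : ℕ} (a b : Fin (g + 1) → ℝ) : ℝ[X] := C 2 * (rootPoly b + rootPoly a)

lemma coeff_poleP (a b : Fin (g + 1) → ℝ) : (poleP a b).coeff g = totalLength a b := by
  rw [poleP, coeff_sub, coeff_rootPoly_pred, coeff_rootPoly_pred, totalLength]
  ring

/-- A and B are both monic of degree g + 1, so the top terms cancel; by `coeff_poleP` the next
coefficient is the length Λ. -/
lemma natDegree_poleP_le (a b : Fin (g + 1) → ℝ) : (poleP a b).natDegree ≤ g := by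
  rw [natDegree_le_iff_coeff_eq_zero]
  intro N hN
  rw [poleP, coeff_sub]
  rcases (Nat.succ_le_of_lt hN).eq_or_lt with h | h
  · rw [← h, coeff_rootPoly_card, coeff_rootPoly_card, sub_self]
  · rw [coeff_eq_zero_of_natDegree_lt (by rwa [natDegree_rootPoly]),
      coeff_eq_zero_of_natDegree_lt (by rwa [natDegree_rootPoly]), sub_self]

/-- |A| - |B| changes sign across the gap because A vanishes at one end and B at the other. At a
zero, A = ±B, and A B > 0 in the gap excludes the minus sign. -/
lemma exists_eval_eq_in_gap (hab : IsGapData a b) (j : Fin g) :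
    ∃ x ∈ Set.Ioo (a j.succ) (b j.succ), (rootPoly b).eval x = (rootPoly a).eval x := by
  set f : ℝ → ℝ := fun x => |(rootPoly a).eval x| - |(rootPoly b).eval x| with hf
  have hcont : ContinuousOn f (Set.Icc (a j.succ) (b j.succ)) := by
    apply Continuous.continuousOn
    exact (rootPoly a).continuous.abs.sub (rootPoly b).continuous.abs
  have hne : ∀ i k, a i - b k ≠ 0 := fun i k => sub_ne_zero.2 (left_ne_right hab i k)
  have h1 : f (a j.succ) < 0 := by
    simp only [hf, eval_rootPoly]
    rw [Finset.prod_eq_zero (Finset.mem_univ j.succ) (sub_self _), abs_zero, zero_sub,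
      neg_lt_zero, abs_pos]
    exact Finset.prod_ne_zero_iff.2 fun k _ => hne _ k
  have h2 : 0 < f (b j.succ) := by
    simp only [hf, eval_rootPoly]
    rw [Finset.prod_eq_zero (f := fun i => b j.succ - b i) (Finset.mem_univ j.succ) (sub_self _),
      abs_zero, sub_zero, abs_pos]
    exact Finset.prod_ne_zero_iff.2 fun k _ => by
      rw [← neg_sub]; exact neg_ne_zero.2 (hne k _)
  obtain ⟨x, hx, hfx⟩ := intermediate_value_Ioo (hab.lt_right j).le hcont ⟨h1, h2⟩
  refine ⟨x, hx, ?_⟩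
  have hpos := prod_endpoints_pos hab (x := x) fun h => h.2 (Set.mem_iUnion.2 ⟨j, hx⟩)
  rw [← eval_rootPoly, ← eval_rootPoly] at hpos
  have habs : |(rootPoly a).eval x| = |(rootPoly b).eval x| := sub_eq_zero.1 hfx
  rcases abs_eq_abs.1 habs with h | h
  · exact h.symm
  · rw [h] at hpos
    nlinarith [sq_nonneg ((rootPoly b).eval x)]

/-- The coefficients and the poles of the rational function `Δ`. -/
structure IsPoleData {g : ℕ} (a b : Fin (g + 1) → ℝ) (lam c : Fin (g + 1) → ℝ) : Prop where
  pos : ∀ j, 0 < lam j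
  mem_gap : ∀ j : Fin g, c j.succ ∈ Set.Ioo (a j.succ) (b j.succ)
  poleP_eq : poleP a b = C (totalLength a b) * rootPoly (fun j : Fin g => c j.succ)
  numP_eq : numP a b = (C (lam 0) * X + C (c 0)) * poleP a b - ∑ j : Fin g,
    C (lam j.succ * totalLength a b) *
      Lagrange.nodal (Finset.univ.erase j) (fun j : Fin g => c j.succ)

lemma injective_of_mem_gap (hab : IsGapData a b) {c : Fin g → ℝ}
    (hc : ∀ j, c j ∈ Set.Ioo (a j.succ) (b j.succ)) : Function.Injective c := by
  intro i j h
  by_contra hij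
  have hi := hc i
  rw [h] at hi
  rcases gap_pair_same_side hab hij (hc j) with h' | h'
  · exact lt_asymm h' hi.1
  · exact lt_asymm h' hi.2

/-- The factors are paired by gap: for i ≠ j, both a i and c i lie on the same side of c j. What
remains is c j - a 0 < 0 and c j - a j > 0. This sign makes the coefficients of Δ positive. -/
lemma prod_left_mul_prod_erase_neg (hab : IsGapData a b) {c : Fin g → ℝ}
    (hc : ∀ j, c j ∈ Set.Ioo (a j.succ) (b j.succ)) (j : Fin g) :
    (∏ i, (c j - a i)) * ∏ i ∈ Finset.univ.erase j, (c j - c i) < 0 := by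
  rw [Fin.prod_univ_succ, ← Finset.mul_prod_erase _ _ (Finset.mem_univ j), mul_assoc, mul_assoc,
    ← Finset.prod_mul_distrib]
  refine mul_neg_of_neg_of_pos ?_ (mul_pos ?_ (Finset.prod_pos fun i hi => ?_))
  · linarith [(gap_subset_Ioo hab j (hc j)).2]
  · linarith [(hc j).1]
  · rcases gap_pair_same_side hab (Finset.ne_of_mem_erase hi) (hc j) with h | h
    · exact mul_pos_of_neg_of_neg (by linarith) (by linarith [(hc i).1])
    · exact mul_pos (by linarith [hab.lt_right i]) (by linarith [(hc i).2])

lemma exists_isPoleData (hab : IsGapData a b) : ∃ lam c, IsPoleData a b lam c := by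
  choose c hc hroot using exists_eval_eq_in_gap hab
  have hΛ := totalLength_pos hab
  have hinj := injective_of_mem_gap hab hc
  -- Both sides have the same coefficient of degree g, so their difference has degree less than g,
  -- and it vanishes at the g points c j.
  have hpole : poleP a b = C (totalLength a b) * rootPoly c := by
    refine eq_of_degree_sub_lt_of_eval_index_eq (v := c) Finset.univ hinj.injOn ?_ ?_
    · rw [degree_lt_iff_coeff_zero]
      intro m hm
      rw [Finset.card_univ, Fintype.card_fin] at hm
      rw [coeff_sub, coeff_C_mul]
      rcases hm.eq_or_lt with rfl | hm
      · rw [coeff_poleP, coeff_rootPoly_card, mul_one, sub_self]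
      · rw [coeff_eq_zero_of_natDegree_lt ((natDegree_poleP_le a b).trans_lt hm),
          coeff_eq_zero_of_natDegree_lt (by rwa [natDegree_rootPoly]), mul_zero, sub_self]
    · intro i _
      rw [poleP, eval_sub, hroot i, sub_self, eval_mul, eval_rootPoly,
        Finset.prod_eq_zero (Finset.mem_univ i) (sub_self _), mul_zero]
  have hmonic : (rootPoly c).Monic := Lagrange.nodal_monic
  set Q := numP a b /ₘ rootPoly c with hQ
  set r := numP a b %ₘ rootPoly c with hr
  have hdecomp : r + rootPoly c * Q = numP a b := modByMonic_add_div _ _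
  have hnumdeg : (numP a b).natDegree ≤ g + 1 := by
    refine natDegree_C_mul_le _ _ |>.trans (natDegree_add_le_of_degree_le ?_ ?_) <;>
      rw [natDegree_rootPoly]
  have hnumcoeff : (numP a b).coeff (g + 1) = 4 := by
    rw [numP, coeff_C_mul, coeff_add, coeff_rootPoly_card, coeff_rootPoly_card]; norm_num
  have hrdeg : r.degree < (g : ℕ) := by
    have := degree_modByMonic_lt (numP a b) hmonic
    rwa [Lagrange.degree_nodal, Finset.card_univ, Fintype.card_fin] at this
  have hQdeg : Q.natDegree ≤ 1 := by
    rw [hQ, natDegree_divByMonic _ hmonic, natDegree_rootPoly]; omega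
  have hQeq : Q = C (Q.coeff 1) * X + C (Q.coeff 0) := eq_X_add_C_of_natDegree_le_one hQdeg
  have hQ1 : Q.coeff 1 = 4 := by
    have h1 : (rootPoly c * Q).coeff (g + 1) = Q.coeff 1 := by
      rw [coeff_mul_add_eq_of_natDegree_le (natDegree_rootPoly c).le hQdeg, coeff_rootPoly_card,
        one_mul]
    rw [← h1, ← hnumcoeff, ← hdecomp, coeff_add,
      coeff_eq_zero_of_degree_lt (hrdeg.trans (by exact_mod_cast Nat.lt_succ_self g)), zero_add]
  -- At c j we have A = B, so the numerator 2 (B + A) equals 4 A there.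
  have hreval : ∀ j, r.eval (c j) = 4 * ∏ i, (c j - a i) := by
    intro j
    have h1 := congrArg (eval (c j)) hdecomp
    rw [eval_add, eval_mul, eval_rootPoly c,
      Finset.prod_eq_zero (Finset.mem_univ j) (sub_self _), zero_mul, add_zero] at h1
    rw [h1, numP, eval_mul, eval_add, hroot j, eval_rootPoly, eval_C]
    ring
  have hrint : r = ∑ j, C (Lagrange.nodalWeight Finset.univ c j * (4 * ∏ i, (c j - a i))) *
      Lagrange.nodal (Finset.univ.erase j) c := by
    conv_lhs => rw [Lagrange.eq_interpolate (s := Finset.univ) (v := c) (f := r) hinj.injOn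
      (by simpa using hrdeg)]
    rw [Lagrange.interpolate_apply]
    refine Finset.sum_congr rfl fun j hj => ?_
    rw [hreval, Lagrange.basis_eq_prod_sub_inv_mul_nodal_div hj,
      ← Lagrange.nodal_erase_eq_nodal_div hj, ← mul_assoc, ← C_mul, mul_comm (4 * _)]
  -- The minus sign comes from writing the fractions as λ / (c - z) instead of λ / (z - c).
  set lam' : Fin g → ℝ := fun j =>
    -(Lagrange.nodalWeight Finset.univ c j * (4 * ∏ i, (c j - a i))) / totalLength a b with hlam'
  refine ⟨Fin.cons (4 / totalLength a b) lam', Fin.cons (Q.coeff 0 / totalLength a b) c,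
    ?_, ?_, ?_, ?_⟩
  · refine Fin.cases ?_ fun j => ?_
    · exact div_pos (by norm_num) hΛ
    · rw [Fin.cons_succ, hlam']
      refine div_pos (neg_pos.2 ?_) hΛ
      rw [Lagrange.nodalWeight_eq_eval_nodal_erase_inv, Lagrange.eval_nodal]
      have hneg := prod_left_mul_prod_erase_neg hab hc j
      set p := ∏ i ∈ Finset.univ.erase j, (c j - c i)
      have hp : p ≠ 0 := right_ne_zero_of_mul hneg.ne
      have : p⁻¹ * (4 * ∏ i, (c j - a i)) = 4 * ((∏ i, (c j - a i)) * p) * (p⁻¹) ^ 2 := by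
        field_simp
      rw [this]
      exact mul_neg_of_neg_of_pos (by linarith) (by positivity)
  · intro j
    simpa using hc j
  · simpa using hpole
  · simp only [Fin.cons_zero, Fin.cons_succ]
    rw [← hdecomp, hpole, hrint]
    have hs : ∀ j, C (lam' j * totalLength a b) * Lagrange.nodal (Finset.univ.erase j) c =
      -(C (Lagrange.nodalWeight Finset.univ c j * (4 * ∏ i, (c j - a i))) *
        Lagrange.nodal (Finset.univ.erase j) c) := by
      intro j
      rw [hlam', div_mul_cancel₀ _ hΛ.ne', C_neg, neg_mul]
    rw [Finset.sum_congr rfl fun j _ => hs j, Finset.sum_neg_distrib, sub_neg_eq_add, add_comm]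
    congr 1
    conv_lhs => rw [hQeq, hQ1]
    have e1 : C (4 / totalLength a b) * C (totalLength a b) = (C 4 : ℝ[X]) := by
      rw [← C_mul, div_mul_cancel₀ _ hΛ.ne']
    have e2 : C (Q.coeff 0 / totalLength a b) * C (totalLength a b) = (C (Q.coeff 0) : ℝ[X]) := by
      rw [← C_mul, div_mul_cancel₀ _ hΛ.ne']
    rw [← e1, ← e2]
    ring

/-- The partial fraction expansion of `Δ` in any field that contains the real polynomials. -/
lemma IsPoleData.map_numP_div {lam c : Fin (g + 1) → ℝ} (h : IsPoleData a b lam c)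
    {K : Type*} [Field K] (φ : ℝ[X] →+* K) (hφ : φ (poleP a b) ≠ 0) :
    φ (numP a b) / φ (poleP a b) = φ (C (lam 0)) * φ X + φ (C (c 0)) +
      ∑ j : Fin g, φ (C (lam j.succ)) / (φ (C (c j.succ)) - φ X) := by
  rw [div_eq_iff hφ, h.numP_eq, map_sub, map_mul, map_add, map_mul,
    add_mul (_ + _) (Finset.sum _ _), sub_eq_add_neg]
  congr 1
  rw [Finset.sum_mul, map_sum, ← Finset.sum_neg_distrib]
  refine Finset.sum_congr rfl fun j _ => ?_
  have e : φ (poleP a b) = φ (C (totalLength a b)) * ((φ X - φ (C (c j.succ))) *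
      φ (Lagrange.nodal (Finset.univ.erase j) (fun j : Fin g => c j.succ))) := by
    rw [h.poleP_eq, map_mul, rootPoly, Lagrange.nodal_eq_mul_nodal_erase (Finset.mem_univ j),
      map_mul, map_sub]
  have hne : φ X - φ (C (c j.succ)) ≠ 0 := by
    intro h0
    rw [h0, zero_mul, mul_zero] at e
    exact hφ e
  have hne' : φ (C (c j.succ)) - φ X ≠ 0 := by
    rw [← neg_sub]; exact neg_ne_zero.2 hne
  rw [e, C_mul, map_mul, map_mul]
  field_simp
  ring

end RationalFunction

/-! ### Values of Δ, the Herglotz property and the preimage of [-2, 2] -/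

section Evaluation

open Polynomial

lemma isCoprime_rootPoly_of_ne {m n : ℕ} {a : Fin m → ℝ} {b : Fin n → ℝ}
    (h : ∀ i j, a i ≠ b j) : IsCoprime (rootPoly a) (rootPoly b) := by
  simp only [rootPoly, Lagrange.nodal_eq]
  exact IsCoprime.prod_left fun i _ => IsCoprime.prod_right fun j _ =>
    isCoprime_X_sub_C_of_isUnit_sub (sub_ne_zero.2 (h i j)).isUnit

/-- For coprime N and D the reduced denominator and D divide each other, so they have the same
zeros. At these zeros both evaluations are 0, by the convention x / 0 = 0. -/
lemma ratFunc_div_spec {N D : ℂ[X]} (hcop : IsCoprime N D) (hD : D ≠ 0) (z : ℂ) :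
    ((algebraMap ℂ[X] (RatFunc ℂ) N / algebraMap ℂ[X] (RatFunc ℂ) D).denom.eval z = 0 ↔
      D.eval z = 0) ∧
    (algebraMap ℂ[X] (RatFunc ℂ) N / algebraMap ℂ[X] (RatFunc ℂ) D).eval (RingHom.id ℂ) z =
      N.eval z / D.eval z := by
  set R := algebraMap ℂ[X] (RatFunc ℂ) N / algebraMap ℂ[X] (RatFunc ℂ) D with hR
  have hD' : algebraMap ℂ[X] (RatFunc ℂ) D ≠ 0 := RatFunc.algebraMap_ne_zero hD
  have hden : algebraMap ℂ[X] (RatFunc ℂ) R.denom ≠ 0 :=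
    RatFunc.algebraMap_ne_zero R.denom_ne_zero
  have hcross : R.num * D = N * R.denom := by
    have h1 := R.num_div_denom
    rw [hR, div_eq_div_iff hden hD', ← map_mul, ← map_mul] at h1
    exact RatFunc.algebraMap_injective ℂ h1
  have d1 : D ∣ R.denom := hcop.symm.dvd_of_dvd_mul_left (Dvd.intro_left _ hcross)
  have d2 : R.denom ∣ D :=
    R.isCoprime_num_denom.symm.dvd_of_dvd_mul_left (Dvd.intro_left _ hcross.symm)
  have hz : R.denom.eval z = 0 ↔ D.eval z = 0 :=
    ⟨fun h => eval_eq_zero_of_dvd_of_eval_eq_zero d2 h,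
      fun h => eval_eq_zero_of_dvd_of_eval_eq_zero d1 h⟩
  refine ⟨hz, ?_⟩
  rw [RatFunc.eval, eval₂_id, eval₂_id]
  by_cases h : D.eval z = 0
  · rw [h, hz.2 h, div_zero, div_zero]
  · rw [div_eq_div_iff (fun h' => h (hz.1 h')) h]
    simpa using congrArg (eval z) hcross

variable {g : ℕ} {a b : Fin (g + 1) → ℝ}

lemma aeval_rootPoly {n : ℕ} (a : Fin n → ℝ) (z : ℂ) :
    aeval z (rootPoly a) = ∏ j, (z - a j) := by
  simp [rootPoly, Lagrange.nodal_eq, map_prod]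

lemma aeval_poleP (z : ℂ) :
    aeval z (poleP a b) = aeval z (rootPoly b) - aeval z (rootPoly a) := by
  rw [poleP, map_sub]

lemma aeval_numP (z : ℂ) :
    aeval z (numP a b) = 2 * (aeval z (rootPoly b) + aeval z (rootPoly a)) := by
  rw [numP, map_mul, map_add, aeval_C]; simp

lemma aeval_left_ne_zero (hab : IsGapData a b) {z : ℂ} (hz : z ∉ gapSet a b) :
    aeval z (rootPoly a) ≠ 0 := by
  rw [aeval_rootPoly]
  refine Finset.prod_ne_zero_iff.2 fun j _ h => hz ?_
  rw [sub_eq_zero.1 h, ofReal_mem_gapSet]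
  exact left_mem_realGapSet hab j

lemma aeval_poleP_ne_zero (hab : IsGapData a b) {z : ℂ} (hz : z.im ≠ 0) :
    aeval z (poleP a b) ≠ 0 := by
  obtain ⟨lam, c, h⟩ := exists_isPoleData hab
  rw [h.poleP_eq, map_mul, aeval_rootPoly, aeval_C]
  refine mul_ne_zero (Complex.ofReal_ne_zero.2 (totalLength_pos hab).ne')
    (Finset.prod_ne_zero_iff.2 fun _ _ h => hz ?_)
  rw [sub_eq_zero.1 h, Complex.ofReal_im]

lemma poleP_ne_zero (hab : IsGapData a b) : poleP a b ≠ 0 := by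
  intro h
  have := coeff_poleP a b
  rw [h, coeff_zero] at this
  exact (totalLength_pos hab).ne this

/-- The rational function `2 (∏ (z - b j) + ∏ (z - a j)) / (∏ (z - b j) - ∏ (z - a j))`. -/
def delta {g : ℕ} (a b : Fin (g + 1) → ℝ) : RatFunc ℂ :=
  algebraMap ℂ[X] (RatFunc ℂ) ((numP a b).map Complex.ofRealHom) /
    algebraMap ℂ[X] (RatFunc ℂ) ((poleP a b).map Complex.ofRealHom)

lemma isCoprime_numP_poleP (hab : IsGapData a b) : IsCoprime (numP a b) (poleP a b) := by
  obtain ⟨u, v, huv⟩ := isCoprime_rootPoly_of_ne (left_ne_right hab)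
  refine ⟨C (1 / 4) * (u + v), C (1 / 2) * (v - u), ?_⟩
  have h4 : C (1 / 4) * C 2 = (C (1 / 2) : ℝ[X]) := by rw [← C_mul]; norm_num
  have h2 : C (1 / 2) + C (1 / 2) = (1 : ℝ[X]) := by rw [← C_add]; norm_num
  rw [numP, poleP]
  linear_combination huv + (u + v) * (rootPoly b + rootPoly a) * h4 +
    (v * rootPoly b + u * rootPoly a) * h2

lemma eval_map_ofReal (P : ℝ[X]) (z : ℂ) : (P.map Complex.ofRealHom).eval z = aeval z P := by
  rw [eval_map, aeval_def]; rfl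

lemma delta_denom_eval (hab : IsGapData a b) (z : ℂ) :
    (delta a b).denom.eval z = 0 ↔ aeval z (poleP a b) = 0 := by
  have h := (ratFunc_div_spec (z := z) ((isCoprime_numP_poleP hab).map (mapRingHom
    Complex.ofRealHom)) ((Polynomial.map_ne_zero_iff Complex.ofRealHom.injective).2
      (poleP_ne_zero hab))).1
  rw [← eval_map_ofReal]
  exact h

lemma delta_eval (hab : IsGapData a b) (z : ℂ) :
    (delta a b).eval (RingHom.id ℂ) z = aeval z (numP a b) / aeval z (poleP a b) := by
  have h := (ratFunc_div_spec (z := z) ((isCoprime_numP_poleP hab).map (mapRingHom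
    Complex.ofRealHom)) ((Polynomial.map_ne_zero_iff Complex.ofRealHom.injective).2
      (poleP_ne_zero hab))).2
  rw [← eval_map_ofReal, ← eval_map_ofReal]
  exact h

lemma IsPoleData.delta_eq (hab : IsGapData a b) {lam c : Fin (g + 1) → ℝ}
    (h : IsPoleData a b lam c) :
    delta a b = RatFunc.C (lam 0 : ℂ) * RatFunc.X + RatFunc.C (c 0 : ℂ) +
      ∑ j : Fin g, RatFunc.C (lam j.succ : ℂ) / (RatFunc.C (c j.succ : ℂ) - RatFunc.X) := by
  have h1 := h.map_numP_div ((algebraMap ℂ[X] (RatFunc ℂ)).comp (mapRingHom Complex.ofRealHom))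
    (RatFunc.algebraMap_ne_zero ((Polynomial.map_ne_zero_iff Complex.ofRealHom.injective).2
      (poleP_ne_zero hab)))
  simpa [delta] using h1

lemma IsPoleData.aeval_div {lam c : Fin (g + 1) → ℝ} (h : IsPoleData a b lam c) {z : ℂ}
    (hz : aeval z (poleP a b) ≠ 0) :
    aeval z (numP a b) / aeval z (poleP a b) =
      lam 0 * z + c 0 + ∑ j : Fin g, (lam j.succ : ℂ) / (c j.succ - z) := by
  have h1 := h.map_numP_div (aeval (R := ℝ) z : ℝ[X] →ₐ[ℝ] ℂ).toRingHom hz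
  simpa using h1

/-- Each term λ / (c - z) has imaginary part λ Im z / |c - z|². Thus Δ is real only on the real
line. -/
lemma IsPoleData.aeval_div_im {lam c : Fin (g + 1) → ℝ} (h : IsPoleData a b lam c) {z : ℂ}
    (hz : aeval z (poleP a b) ≠ 0) :
    (aeval z (numP a b) / aeval z (poleP a b)).im =
      z.im * (lam 0 + ∑ j : Fin g, lam j.succ / Complex.normSq (c j.succ - z)) := by
  rw [h.aeval_div hz, Complex.add_im, Complex.add_im, Complex.im_sum, mul_add, Finset.mul_sum]
  congr 1
  · simp; ring
  · refine Finset.sum_congr rfl fun j _ => ?_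
    rw [Complex.div_im]
    simp
    ring

lemma IsPoleData.slope_pos {lam c : Fin (g + 1) → ℝ} (h : IsPoleData a b lam c) (z : ℂ) :
    0 < lam 0 + ∑ j : Fin g, lam j.succ / Complex.normSq (c j.succ - z) :=
  add_pos_of_pos_of_nonneg (h.pos 0) (Finset.sum_nonneg fun _ _ =>
    div_nonneg (h.pos _).le (Complex.normSq_nonneg _))

lemma isHerglotz_delta (hab : IsGapData a b) : IsHerglotz (delta a b) := by
  obtain ⟨lam, c, h⟩ := exists_isPoleData hab
  intro z hz hz'
  rw [Ne, delta_denom_eval hab] at hz'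
  rw [delta_eval hab, h.aeval_div_im hz']
  exact mul_pos hz (h.slope_pos z)

lemma sphereEval_delta (hab : IsGapData a b) (z : ℂ) :
    sphereEval (delta a b) z = if aeval z (poleP a b) = 0 then OnePoint.infty else
      ((aeval z (numP a b) / aeval z (poleP a b) : ℂ) : OnePoint ℂ) := by
  rw [sphereEval, delta_eval hab]
  simp only [delta_denom_eval hab]

lemma aeval_ofReal (P : ℝ[X]) (x : ℝ) : aeval (x : ℂ) P = (P.eval x : ℝ) := by
  simpa using aeval_algebraMap_apply ℂ x P

lemma bandPreimage_delta (hab : IsGapData a b) : bandPreimage (delta a b) = gapSet a b := by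
  obtain ⟨lam, c, hpd⟩ := exists_isPoleData hab
  have hreal : ∀ x : ℝ, (x : ℂ) ∈ bandPreimage (delta a b) ↔ x ∈ realGapSet a b := by
    intro x
    rw [mem_realGapSet_iff hab, ← eval_rootPoly, ← eval_rootPoly]
    simp only [bandPreimage, Set.mem_ofPred_eq, sphereEval_delta hab, aeval_ofReal,
      Complex.ofReal_eq_zero, ← Complex.ofReal_div]
    have hne : (rootPoly a).eval x = 0 → (rootPoly b).eval x ≠ 0 := by
      simp only [eval_rootPoly]
      intro h h'
      obtain ⟨i, -, hi⟩ := Finset.prod_eq_zero_iff.1 h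
      obtain ⟨j, -, hj⟩ := Finset.prod_eq_zero_iff.1 h'
      exact left_ne_right hab i j (by linarith)
    have hN : (numP a b).eval x = 2 * ((rootPoly b).eval x + (rootPoly a).eval x) := by
      simp [numP]
    have hD : (poleP a b).eval x = (rootPoly b).eval x - (rootPoly a).eval x := by
      simp [poleP]
    set A := (rootPoly a).eval x
    set B := (rootPoly b).eval x
    rw [hN, hD]
    by_cases h0 : B - A = 0
    · rw [if_pos h0]
      have hBA : B = A := sub_eq_zero.1 h0
      constructor
      · rintro ⟨t, -, ht⟩
        exact absurd ht (OnePoint.infty_ne_coe _)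
      · intro h
        have hA : A ≠ 0 := fun hA => hne hA (hBA.trans hA)
        rw [hBA] at h
        exact absurd h (not_le.2 (mul_self_pos.2 hA))
    · rw [if_neg h0]
      have hsq : 0 < (B - A) ^ 2 := by positivity
      -- Δ² - 4 has the sign of A B, hence |Δ| ≤ 2 exactly when A B ≤ 0.
      have key : (2 * (B + A) / (B - A)) ^ 2 - 4 = 16 * (A * B) / (B - A) ^ 2 := by
        field_simp
        ring
      constructor
      · rintro ⟨t, ht, ht'⟩
        rw [OnePoint.coe_eq_coe, Complex.ofReal_inj] at ht'
        rw [ht'] at key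
        have : 16 * (A * B) / (B - A) ^ 2 ≤ 0 := by
          rw [← key]; nlinarith [ht.1, ht.2]
        rw [div_le_iff₀ hsq] at this
        linarith
      · intro h
        refine ⟨_, ?_, rfl⟩
        have : 16 * (A * B) / (B - A) ^ 2 ≤ 0 :=
          div_nonpos_of_nonpos_of_nonneg (by linarith) hsq.le
        rw [← key] at this
        exact abs_le.1 (abs_le_of_sq_le_sq (by linarith) (by norm_num))
  ext z
  by_cases hz : z.im = 0
  · have hz' : z = (z.re : ℂ) := Complex.ext rfl (by simp [hz])
    rw [hz', hreal, ofReal_mem_gapSet]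
  · refine iff_of_false ?_ fun h => hz (mem_gapSet.1 h).1
    rintro ⟨t, -, ht⟩
    rw [sphereEval_delta hab, if_neg (aeval_poleP_ne_zero hab hz), OnePoint.coe_eq_coe] at ht
    have := hpd.aeval_div_im (aeval_poleP_ne_zero hab hz)
    rw [ht, Complex.ofReal_im] at this
    exact mul_ne_zero hz (hpd.slope_pos z).ne' this.symm

end Evaluation

/-! ### Behaviour at infinity -/

section Asymptotics

open Polynomial

lemma tendsto_inv_cocompact : Tendsto (fun z : ℂ => z⁻¹) (cocompact ℂ) (𝓝 0) := by
  rw [← Metric.cobounded_eq_cocompact]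
  exact tendsto_inv₀_cobounded

lemma tendsto_inv_pow_cocompact {k : ℕ} (hk : k ≠ 0) :
    Tendsto (fun z : ℂ => (z ^ k)⁻¹) (cocompact ℂ) (𝓝 0) := by
  have := tendsto_inv_cocompact.pow k
  simpa [hk] using this

lemma eventually_cocompact_ne (z₀ : ℂ) : ∀ᶠ z : ℂ in cocompact ℂ, z ≠ z₀ :=
  (isCompact_singleton (x := z₀)).compl_mem_cocompact

lemma tendsto_eval_div_pow (P : ℂ[X]) {n : ℕ} (hP : P.natDegree ≤ n) :
    Tendsto (fun z : ℂ => P.eval z / z ^ n) (cocompact ℂ) (𝓝 (P.coeff n)) := by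
  have h1 : ∀ i ∈ Finset.range (n + 1), Tendsto (fun z : ℂ => P.coeff i * z ^ i / z ^ n)
      (cocompact ℂ) (𝓝 (if i = n then (P.coeff n) else 0)) := by
    intro i hi
    split_ifs with h
    · subst h
      refine tendsto_const_nhds.congr' ?_
      filter_upwards [eventually_cocompact_ne 0] with z hz
      field_simp
    · have hin : i < n := lt_of_le_of_ne (Nat.lt_succ_iff.1 (Finset.mem_range.1 hi)) h
      have h2 := (tendsto_inv_pow_cocompact (Nat.sub_ne_zero_of_lt hin)).const_mul (P.coeff i)
      rw [mul_zero] at h2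
      refine h2.congr' ?_
      filter_upwards [eventually_cocompact_ne 0] with z hz
      have : z ^ n = z ^ i * z ^ (n - i) := by rw [← pow_add, Nat.add_sub_cancel' hin.le]
      rw [this]
      field_simp
  have h2 := tendsto_finsetSum _ h1
  rw [Finset.sum_ite_eq' (Finset.range (n + 1)) n, if_pos (by simp)] at h2
  refine h2.congr fun z => ?_
  rw [eval_eq_sum_range' (Nat.lt_succ_of_le hP), Finset.sum_div]

lemma tendsto_aeval_div_pow (P : ℝ[X]) {n : ℕ} (hP : P.natDegree ≤ n) :
    Tendsto (fun z : ℂ => aeval z P / z ^ n) (cocompact ℂ) (𝓝 (P.coeff n : ℂ)) := by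
  simpa [eval_map_ofReal] using
    tendsto_eval_div_pow (P.map Complex.ofRealHom) (natDegree_map_le.trans hP)

variable {g : ℕ} {a b : Fin (g + 1) → ℝ}

lemma eventually_not_mem_gapSet (a b : Fin (g + 1) → ℝ) :
    ∀ᶠ z : ℂ in cocompact ℂ, z ∉ gapSet a b :=
  isCompact_gapSet.compl_mem_cocompact

lemma tendsto_right_div_left (a b : Fin (g + 1) → ℝ) :
    Tendsto (fun z : ℂ => aeval z (rootPoly b) / aeval z (rootPoly a)) (cocompact ℂ) (𝓝 1) := by
  have h := (tendsto_aeval_div_pow (rootPoly b) (natDegree_rootPoly b).le).div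
    (tendsto_aeval_div_pow (rootPoly a) (natDegree_rootPoly a).le)
    (by rw [coeff_rootPoly_card]; simp)
  rw [coeff_rootPoly_card, coeff_rootPoly_card] at h
  simp only [Complex.ofReal_one, div_one] at h
  refine h.congr' ?_
  filter_upwards [eventually_cocompact_ne 0] with z hz
  rw [Pi.div_apply, div_div_div_cancel_right₀ (pow_ne_zero _ hz)]

lemma tendsto_mul_poleP_div_left (a b : Fin (g + 1) → ℝ) :
    Tendsto (fun z : ℂ => z * (aeval z (poleP a b) / aeval z (rootPoly a))) (cocompact ℂ)
      (𝓝 (totalLength a b : ℂ)) := by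
  have h := (tendsto_aeval_div_pow (poleP a b) (natDegree_poleP_le a b)).div
    (tendsto_aeval_div_pow (rootPoly a) (natDegree_rootPoly a).le)
    (by rw [coeff_rootPoly_card]; simp)
  rw [coeff_rootPoly_card, coeff_poleP] at h
  simp only [Complex.ofReal_one, div_one] at h
  refine h.congr' ?_
  filter_upwards [eventually_cocompact_ne 0] with z hz
  rw [Pi.div_apply, pow_succ]
  field_simp

lemma tendsto_cocompact_add_of_tendsto {f h : ℂ → ℂ} {l : Filter ℂ} {w : ℂ}
    (hf : Tendsto f l (cocompact ℂ)) (hh : Tendsto h l (𝓝 w)) :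
    Tendsto (fun z => f z + h z) l (cocompact ℂ) := by
  rw [← Metric.cobounded_eq_cocompact, ← tendsto_norm_atTop_iff_cobounded] at *
  have hbd : ∀ᶠ z in l, ‖h z‖ ≤ ‖w‖ + 1 := hh.norm.eventually_le_const (lt_add_one _)
  refine tendsto_atTop_mono' l ?_ (tendsto_atTop_add_const_right l (-(‖w‖ + 1)) hf)
  filter_upwards [hbd] with z hz
  have := norm_sub_le (f z + h z) (h z)
  rw [add_sub_cancel_right] at this
  linarith

lemma hasPoleAtInfinity_delta (hab : IsGapData a b) : HasPoleAtInfinity (delta a b) := by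
  obtain ⟨lam, c, h⟩ := exists_isPoleData hab
  have hsum : Tendsto (fun z : ℂ => (c 0 : ℂ) + ∑ j : Fin g, (lam j.succ : ℂ) / (c j.succ - z))
      (cocompact ℂ) (𝓝 ((c 0 : ℂ) + ∑ j : Fin g, 0)) := by
    refine tendsto_const_nhds.add (tendsto_finsetSum _ fun j _ => ?_)
    have h1 : Tendsto (fun z : ℂ => (c j.succ : ℂ) - z) (cocompact ℂ) (cocompact ℂ) :=
      (Homeomorph.subLeft (c j.succ : ℂ)).isClosedEmbedding.tendsto_cocompact
    simpa [div_eq_mul_inv] using (tendsto_inv_cocompact.comp h1).const_mul (lam j.succ : ℂ)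
  have hlin : Tendsto (fun z : ℂ => (lam 0 : ℂ) * z) (cocompact ℂ) (cocompact ℂ) :=
    (Homeomorph.mulLeft₀ (lam 0 : ℂ)
      (Complex.ofReal_ne_zero.2 (h.pos 0).ne')).isClosedEmbedding.tendsto_cocompact
  have hpole : ∀ᶠ z : ℂ in cocompact ℂ, aeval z (poleP a b) ≠ 0 := by
    have h1 := (tendsto_mul_poleP_div_left a b).eventually_ne
      (Complex.ofReal_ne_zero.2 (totalLength_pos hab).ne')
    filter_upwards [h1] with z hz h0
    rw [h0] at hz
    simp at hz
  have hadd := tendsto_cocompact_add_of_tendsto hlin hsum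
  refine hadd.congr' ?_
  filter_upwards [hpole] with z hz
  rw [delta_eval hab, h.aeval_div hz, add_assoc]

end Asymptotics

/-! ### The explicit extremal function -/

section Extremal

open Polynomial

variable {g : ℕ} {a b : Fin (g + 1) → ℝ}

/-- On the real line off E, A B > 0. Off the real line, B / A = (Δ + 2) / (Δ - 2), so a real ratio
would force Δ to be real there, against the Herglotz property. -/
lemma ratio_mem_slitPlane (hab : IsGapData a b) {z : ℂ} (hz : z ∉ gapSet a b) :
    aeval z (rootPoly b) / aeval z (rootPoly a) ∈ Complex.slitPlane := by
  by_cases him : z.im = 0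
  · have hz' : z = (z.re : ℂ) := Complex.ext rfl (by simp [him])
    rw [hz'] at hz ⊢
    rw [ofReal_mem_gapSet] at hz
    have hpos := prod_endpoints_pos hab hz
    rw [← eval_rootPoly, ← eval_rootPoly] at hpos
    rw [aeval_ofReal, aeval_ofReal, ← Complex.ofReal_div, Complex.ofReal_mem_slitPlane]
    rcases mul_pos_iff.1 hpos with h | h
    · exact div_pos h.2 h.1
    · exact div_pos_of_neg_of_neg h.2 h.1
  · refine Or.inr fun h0 => ?_
    obtain ⟨lam, c, h⟩ := exists_isPoleData hab
    have hD := aeval_poleP_ne_zero hab him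
    have hA := aeval_left_ne_zero hab hz
    have h1 := h.aeval_div_im hD
    set q := aeval z (rootPoly b) / aeval z (rootPoly a) with hq
    have hqr : q = (q.re : ℂ) := Complex.ext rfl (by simp [h0])
    have hB : aeval z (rootPoly b) = q * aeval z (rootPoly a) := by rw [hq]; field_simp
    have h2 : aeval z (numP a b) / aeval z (poleP a b) = (2 * (q.re + 1) / (q.re - 1) : ℝ) := by
      push_cast
      rw [← hqr]
      have hq1 : q - 1 ≠ 0 := by
        intro h
        apply hD
        rw [aeval_poleP, hB]
        linear_combination aeval z (rootPoly a) * h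
      rw [div_eq_div_iff hD hq1, aeval_numP, aeval_poleP, hB]
      ring
    rw [h2, Complex.ofReal_im] at h1
    exact mul_ne_zero him (h.slope_pos z).ne' h1.symm

/-- The square root of `∏ (z - b j) / ∏ (z - a j)` with positive real part. -/
def sqrtRatio {g : ℕ} (a b : Fin (g + 1) → ℝ) (z : ℂ) : ℂ :=
  (aeval z (rootPoly b) / aeval z (rootPoly a)) ^ (1 / 2 : ℂ)

lemma sqrtRatio_sq (a b : Fin (g + 1) → ℝ) (z : ℂ) :
    sqrtRatio a b z ^ 2 = aeval z (rootPoly b) / aeval z (rootPoly a) := by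
  rw [sqrtRatio, ← Complex.cpow_nat_mul]
  norm_num

lemma re_cpow_half_pos {q : ℂ} (hq : q ∈ Complex.slitPlane) : 0 < (q ^ (1 / 2 : ℂ)).re := by
  have hq0 := Complex.slitPlane_ne_zero hq
  rw [Complex.cpow_def_of_ne_zero hq0, Complex.exp_re]
  refine mul_pos (Real.exp_pos _) (Real.cos_pos_of_mem_Ioo ?_)
  have h1 : (Complex.log q * (1 / 2)).im = q.arg / 2 := by
    rw [show (1 / 2 : ℂ) = ((1 / 2 : ℝ) : ℂ) by norm_num, Complex.im_mul_ofReal, Complex.log_im]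
    ring
  rw [h1]
  have h2 := Complex.neg_pi_lt_arg q
  have h3 := (Complex.arg_le_pi q).lt_of_ne (Complex.mem_slitPlane_iff_arg.1 hq).1
  constructor <;> linarith

lemma sqrtRatio_re_pos (hab : IsGapData a b) {z : ℂ} (hz : z ∉ gapSet a b) :
    0 < (sqrtRatio a b z).re :=
  re_cpow_half_pos (ratio_mem_slitPlane hab hz)

lemma sqrtRatio_add_one_ne_zero (hab : IsGapData a b) {z : ℂ} (hz : z ∉ gapSet a b) :
    sqrtRatio a b z + 1 ≠ 0 := by
  intro h
  have h1 := congrArg Complex.re h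
  rw [Complex.add_re, Complex.one_re, Complex.zero_re] at h1
  linarith [sqrtRatio_re_pos hab hz]

lemma tendsto_sqrtRatio (a b : Fin (g + 1) → ℝ) :
    Tendsto (sqrtRatio a b) (cocompact ℂ) (𝓝 1) := by
  have h := (tendsto_right_div_left a b).cpow (tendsto_const_nhds (x := (1 / 2 : ℂ)))
    Complex.one_mem_slitPlane
  rwa [Complex.one_cpow] at h

lemma differentiable_aeval (P : ℝ[X]) : Differentiable ℂ fun z : ℂ => aeval z P := by
  simp only [← eval_map_ofReal]
  exact Polynomial.differentiable _

lemma differentiableOn_sqrtRatio (hab : IsGapData a b) :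
    DifferentiableOn ℂ (sqrtRatio a b) (gapSet a b)ᶜ := by
  intro z hz
  refine DifferentiableAt.differentiableWithinAt ?_
  refine DifferentiableAt.cpow ?_ (differentiableAt_const _) (ratio_mem_slitPlane hab hz)
  exact (differentiable_aeval _ z).div (differentiable_aeval _ z) (aeval_left_ne_zero hab hz)

/-- The extremal function `(s - 1) / (s + 1)` with `s ^ 2 = ∏ (z - b j) / ∏ (z - a j)`. -/
def extremal {g : ℕ} (a b : Fin (g + 1) → ℝ) (z : ℂ) : ℂ :=
  (sqrtRatio a b z - 1) / (sqrtRatio a b z + 1)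

lemma norm_sub_one_le_norm_add_one {s : ℂ} (hs : 0 ≤ s.re) : ‖s - 1‖ ≤ ‖s + 1‖ := by
  rw [Complex.norm_def, Complex.norm_def]
  refine Real.sqrt_le_sqrt ?_
  simp only [Complex.normSq_apply, Complex.sub_re, Complex.add_re, Complex.sub_im, Complex.add_im,
    Complex.one_re, Complex.one_im]
  nlinarith

/-- (s - 1) / (s + 1) = (s² - 1) / (s + 1)², where s² - 1 = (B - A) / A behaves like Λ / z and s →
1. -/
lemma tendsto_mul_extremal (hab : IsGapData a b) :
    Tendsto (fun z => z * extremal a b z) (cocompact ℂ)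
      (𝓝 ((totalLength a b / 4 : ℝ) : ℂ)) := by
  have h1 : Tendsto (fun z => (sqrtRatio a b z + 1) ^ 2) (cocompact ℂ) (𝓝 ((1 + 1) ^ 2)) :=
    ((tendsto_sqrtRatio a b).add_const 1).pow 2
  have h2 := (tendsto_mul_poleP_div_left a b).div h1 (by norm_num)
  have h3 : ((totalLength a b / 4 : ℝ) : ℂ) = (totalLength a b : ℂ) / (1 + 1) ^ 2 := by
    push_cast; norm_num
  rw [h3]
  refine h2.congr' ?_
  filter_upwards [eventually_not_mem_gapSet a b] with z hz
  have hA := aeval_left_ne_zero hab hz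
  have hs := sqrtRatio_add_one_ne_zero hab hz
  have h4 : aeval z (poleP a b) / aeval z (rootPoly a) = sqrtRatio a b z ^ 2 - 1 := by
    rw [sqrtRatio_sq, aeval_poleP, sub_div, div_self hA]
  rw [Pi.div_apply, h4, extremal]
  field_simp
  ring

lemma tendsto_extremal (a b : Fin (g + 1) → ℝ) :
    Tendsto (extremal a b) (cocompact ℂ) (𝓝 0) := by
  have h := ((tendsto_sqrtRatio a b).sub_const 1).div ((tendsto_sqrtRatio a b).add_const 1)
    (by norm_num)
  rw [sub_self, zero_div] at h
  exact h

lemma isCompetitor_extremal (hab : IsGapData a b) :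
    IsCompetitor (gapSet a b) (extremal a b) where
  differentiableOn := ((differentiableOn_sqrtRatio hab).sub_const 1).div
    ((differentiableOn_sqrtRatio hab).add_const 1) fun _ hz => sqrtRatio_add_one_ne_zero hab hz
  norm_le_one z hz := by
    rw [extremal, norm_div]
    exact div_le_one_of_le₀ (norm_sub_one_le_norm_add_one (sqrtRatio_re_pos hab hz).le)
      (norm_nonneg _)
  tendsto_zero := tendsto_extremal a b

lemma joukowski_extremal (hab : IsGapData a b) {z : ℂ} (hz : z ∉ gapSet a b) :
    joukowski (extremal a b z) = sphereEval (delta a b) z := by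
  have hA := aeval_left_ne_zero hab hz
  have hs := sqrtRatio_add_one_ne_zero hab hz
  have hsq := sqrtRatio_sq a b z
  have hre := sqrtRatio_re_pos hab hz
  rw [joukowski, sphereEval_delta hab]
  rw [extremal]
  set s := sqrtRatio a b z
  have hB : aeval z (rootPoly b) = s ^ 2 * aeval z (rootPoly a) := by rw [hsq]; field_simp
  have hD : aeval z (poleP a b) = (s - 1) * (s + 1) * aeval z (rootPoly a) := by
    rw [aeval_poleP, hB]; ring
  have hiff : (s - 1) / (s + 1) = 0 ↔ aeval z (poleP a b) = 0 := by
    rw [hD]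
    simp [hs, hA]
  by_cases h : aeval z (poleP a b) = 0
  · rw [if_pos h, if_pos (hiff.2 h)]
  · have hne := fun h' => h (hiff.1 h')
    have hs1 : s - 1 ≠ 0 := fun h' => hne (by rw [h', zero_div])
    rw [if_neg h, if_neg hne, OnePoint.coe_eq_coe, aeval_numP, hB, hD]
    field_simp
    ring

end Extremal

/-! ### A contour estimate for the residue at infinity -/

section Contour

open Complex MeasureTheory

variable {S : Set ℝ} {G : ℂ → ℂ}

lemma ofReal_add_mul_I_mem_image {x y : ℝ} :
    (x + y * I : ℂ) ∈ ofReal '' S ↔ y = 0 ∧ x ∈ S := by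
  constructor
  · rintro ⟨t, ht, h⟩
    have h1 := congrArg Complex.re h
    have h2 := congrArg Complex.im h
    simp at h1 h2
    exact ⟨h2.symm, h1 ▸ ht⟩
  · rintro ⟨rfl, hx⟩
    exact ⟨x, hx, by simp⟩

/-- The integral of `G` over the top and the two vertical sides of the rectangle with vertices
`±R`, `±R + R i`. -/
def archIntegral (G : ℂ → ℂ) (R : ℝ) : ℂ :=
  (∫ x : ℝ in (-R)..R, G (x + R * I)) - I * (∫ y : ℝ in (0 : ℝ)..R, G (R + y * I)) +
    I * ∫ y : ℝ in (0 : ℝ)..R, G ((-R : ℝ) + y * I)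

lemma continuous_vertical (hG : ContinuousOn G (ofReal '' S)ᶜ) {x : ℝ} (hx : x ∉ S) :
    Continuous fun y : ℝ => G (x + y * I) :=
  hG.comp_continuous (by fun_prop) fun y h => hx (ofReal_add_mul_I_mem_image.1 h).2

lemma continuous_horizontal (hG : ContinuousOn G (ofReal '' S)ᶜ) {y : ℝ} (hy : y ≠ 0) :
    Continuous fun x : ℝ => G (x + y * I) :=
  hG.comp_continuous (by fun_prop) fun x h => hy (ofReal_add_mul_I_mem_image.1 h).1

lemma tendsto_integral_vertical (hG : ContinuousOn G (ofReal '' S)ᶜ) {x : ℝ} (hx : x ∉ S)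
    (R : ℝ) : Tendsto (fun ε : ℝ => ∫ y : ℝ in ε..R, G (x + y * I)) (𝓝[>] 0)
      (𝓝 (∫ y : ℝ in (0 : ℝ)..R, G (x + y * I))) := by
  have hc := continuous_vertical hG hx
  have h1 : Continuous fun ε : ℝ => ∫ y : ℝ in ε..R, G (x + y * I) := by
    simp_rw [intervalIntegral.integral_symm R]
    exact (intervalIntegral.continuous_primitive (fun _ _ => hc.intervalIntegrable _ _) R).neg
  exact (h1.tendsto 0).mono_left nhdsWithin_le_nhds

/-- Cauchy's theorem on a rectangle lying strictly above the real axis, hence away from S. -/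
lemma horizontal_eq_arch (hd : DifferentiableOn ℂ G (ofReal '' S)ᶜ) {R ε : ℝ}
    (hε : 0 < ε) (hεR : ε < R) :
    ∫ x : ℝ in (-R)..R, G (x + ε * I) =
      (∫ x : ℝ in (-R)..R, G (x + R * I)) - I * (∫ y : ℝ in ε..R, G (R + y * I)) +
        I * ∫ y : ℝ in ε..R, G ((-R : ℝ) + y * I) := by
  have h := integral_boundary_rect_eq_zero_of_differentiableOn G (((-R : ℝ) : ℂ) + ε * I)
    ((R : ℂ) + R * I) (hd.mono ?_)
  · simp only [add_re, add_im, ofReal_re, ofReal_im, mul_re, mul_im, I_re, I_im, mul_zero, mul_one,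
      sub_zero, add_zero, zero_add, smul_eq_mul] at h
    linear_combination h
  · rintro z hz ⟨t, -, rfl⟩
    have h2 := hz.2
    simp [Set.uIcc_of_le hεR.le] at h2
    linarith

/-- Let the horizontal segment at height ε descend to the real axis. Over S the imaginary part is at
most M; off S it tends to 0 boundedly, since G is continuous and real there. -/
lemma abs_im_archIntegral_le (hS : IsCompact S) (hd : DifferentiableOn ℂ G (ofReal '' S)ᶜ)
    {M : ℝ} (hM : ∀ z ∈ (ofReal '' S)ᶜ, |(G z).im| ≤ M)
    (hreal : ∀ x : ℝ, x ∉ S → (G x).im = 0) {R : ℝ} (hR : 0 < R) (hSR : S ⊆ Set.Ioo (-R) R) :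
    |(archIntegral G R).im| ≤ M * volume.real S := by
  have hG := hd.continuousOn
  have hRS : R ∉ S := fun h => lt_irrefl _ (hSR h).2
  have hRS' : -R ∉ S := fun h => lt_irrefl _ (hSR h).1
  have hSm := hS.measurableSet
  have hM0 : 0 ≤ M := (abs_nonneg _).trans (hM R (by
    rintro ⟨t, ht, h⟩
    exact hRS (ofReal_injective h ▸ ht)))
  -- The part of |Im G| that lies over the complement of S; its integral vanishes as ε → 0 by
  -- dominated convergence.
  set k : ℝ → ℝ → ℝ := fun ε => Sᶜ.indicator fun x => |(G (x + ε * I)).im| with hk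
  have hkint : Tendsto (fun ε => ∫ x in (-R)..R, k ε x) (𝓝[>] 0) (𝓝 (∫ x in (-R)..R, (0 : ℝ))) := by
    refine intervalIntegral.tendsto_integral_filter_of_dominated_convergence (fun _ => M) ?_ ?_
      intervalIntegrable_const ?_
    · filter_upwards [self_mem_nhdsWithin] with ε hε
      have hc : Continuous fun x : ℝ => |(G (x + ε * I)).im| :=
        (continuous_im.comp (continuous_horizontal hG (ne_of_gt hε))).abs
      exact (hc.measurable.indicator hSm.compl).aestronglyMeasurable
    · filter_upwards [self_mem_nhdsWithin] with ε hε
      refine Eventually.of_forall fun x _ => ?_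
      rw [hk]
      simp only [Set.indicator]
      split_ifs
      · rw [Real.norm_eq_abs, abs_abs]
        exact hM _ fun h => (ne_of_gt hε) (ofReal_add_mul_I_mem_image.1 h).1
      · simpa using hM0
    · refine Eventually.of_forall fun x _ => ?_
      by_cases hx : x ∈ S
      · simp [hk, hx]
      · have hc := ((continuous_im.comp (continuous_vertical hG hx)).abs.tendsto 0).mono_left
          (nhdsWithin_le_nhds (s := Set.Ioi (0 : ℝ)))
        simp only [Function.comp_apply, ofReal_zero, zero_mul, add_zero, hreal x hx, abs_zero] at hc
        simpa [hk, hx] using hc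
  rw [intervalIntegral.integral_zero] at hkint
  have hvol : ∫ x in (-R)..R, S.indicator (fun _ => M) x = M * volume.real S := by
    rw [intervalIntegral.integral_of_le (by linarith), integral_indicator hSm,
      Measure.restrict_restrict hSm,
      Set.inter_eq_left.2 (hSR.trans Set.Ioo_subset_Ioc_self), setIntegral_const, smul_eq_mul,
      mul_comm]
  have hindint : IntervalIntegrable (S.indicator fun _ => M) volume (-R) R := by
    rw [intervalIntegrable_iff]
    exact (intervalIntegrable_iff.1 intervalIntegrable_const).indicator hSm
  have hbound : ∀ᶠ ε : ℝ in 𝓝[>] 0, |(∫ x : ℝ in (-R)..R, G (x + ε * I)).im| ≤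
      M * volume.real S + ∫ x in (-R)..R, k ε x := by
    filter_upwards [self_mem_nhdsWithin] with ε hε
    have hc := continuous_horizontal hG (ne_of_gt hε)
    have hc' : Continuous fun x : ℝ => |(G (x + ε * I)).im| := (continuous_im.comp hc).abs
    have hkI : IntervalIntegrable (k ε) volume (-R) R := by
      have h1 := hc'.intervalIntegrable (μ := volume) (-R) R
      rw [intervalIntegrable_iff] at h1 ⊢
      exact h1.indicator hSm.compl
    have him : (∫ x : ℝ in (-R)..R, G (x + ε * I)).im =
        ∫ x : ℝ in (-R)..R, (G (x + ε * I)).im :=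
      (imCLM.intervalIntegral_comp_comm (hc.intervalIntegrable (-R) R)).symm
    rw [him, ← hvol, ← intervalIntegral.integral_add hindint hkI]
    refine (intervalIntegral.abs_integral_le_integral_abs (by linarith)).trans ?_
    refine intervalIntegral.integral_mono_on (by linarith) (hc'.intervalIntegrable _ _)
      (hindint.add hkI) fun x _ => ?_
    by_cases hx : x ∈ S
    · simpa [hk, hx] using hM _ fun h => (ne_of_gt hε) (ofReal_add_mul_I_mem_image.1 h).1
    · simp [hk, hx]
  have hlim : Tendsto (fun ε : ℝ => |(∫ x : ℝ in (-R)..R, G (x + ε * I)).im|) (𝓝[>] 0)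
      (𝓝 |(archIntegral G R).im|) := by
    have h1 := (tendsto_const_nhds (x := ∫ x : ℝ in (-R)..R, G (x + R * I))).sub
      ((tendsto_integral_vertical hG hRS R).const_mul I) |>.add
      ((tendsto_integral_vertical hG hRS' R).const_mul I)
    refine ((continuous_im.tendsto _).comp (h1.congr' ?_)).abs
    filter_upwards [Ioo_mem_nhdsGT hR] with ε hε
    rw [horizontal_eq_arch hd hε.1 hε.2]
  have := le_of_tendsto_of_tendsto hlim (hkint.const_add (M * volume.real S)) hbound
  simpa using this

/-- The integrand is (R p) G(R p) / p, which tends to L / p; as |p| ≥ 1, it is eventually dominated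
by ‖L‖ + 1. Rescaling thus reduces the large arch to a fixed one. -/
lemma tendsto_integral_rescaled (hS : IsCompact S) (hG : ContinuousOn G (ofReal '' S)ᶜ) {L : ℂ}
    (hL : Tendsto (fun z => z * G z) (cocompact ℂ) (𝓝 L)) {p : ℝ → ℂ} (hp : Continuous p)
    (hp1 : ∀ t, 1 ≤ ‖p t‖) (α β : ℝ) :
    Tendsto (fun R : ℝ => ∫ t in α..β, (R : ℂ) * G (R * p t)) atTop
      (𝓝 (∫ t in α..β, L / p t)) := by
  have hp0 : ∀ t, p t ≠ 0 := fun t h => by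
    have := hp1 t
    rw [h, norm_zero] at this
    linarith
  have hout : ∀ {s : Set ℂ}, s ∈ cocompact ℂ → ∀ᶠ R : ℝ in atTop, ∀ t, (R : ℂ) * p t ∈ s := by
    intro s hs
    rw [← Metric.cobounded_eq_cocompact] at hs
    obtain ⟨r, -, hr⟩ := (hasBasis_cobounded_norm (E := ℂ)).mem_iff.1 hs
    filter_upwards [eventually_ge_atTop r, eventually_ge_atTop 0] with R hR hR0 t
    refine hr ?_
    show r ≤ ‖(R : ℂ) * p t‖
    rw [norm_mul, norm_real, Real.norm_of_nonneg hR0]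
    exact hR.trans (le_mul_of_one_le_right hR0 (hp1 t))
  refine intervalIntegral.tendsto_integral_filter_of_dominated_convergence (fun _ => ‖L‖ + 1) ?_ ?_
    intervalIntegrable_const ?_
  · filter_upwards [hout (hS.image continuous_ofReal).compl_mem_cocompact] with R hR
    exact (continuous_const.mul
      (hG.comp_continuous (continuous_const.mul hp) hR)).aestronglyMeasurable
  · have hbd : ∀ᶠ z in cocompact ℂ, ‖z * G z‖ ≤ ‖L‖ + 1 :=
      hL.norm.eventually_le_const (lt_add_one _)
    filter_upwards [hout hbd] with R hR
    refine Eventually.of_forall fun t _ => ?_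
    have h1 : ‖(R : ℂ) * G (R * p t)‖ * ‖p t‖ ≤ ‖L‖ + 1 := by
      rw [← norm_mul]
      refine le_of_eq_of_le ?_ (hR t)
      congr 1; ring
    exact (le_mul_of_one_le_right (norm_nonneg _) (hp1 t)).trans h1
  · refine Eventually.of_forall fun t _ => ?_
    have h1 : Tendsto (fun R : ℝ => (R : ℂ) * p t) atTop (cocompact ℂ) := by
      rw [tendsto_def]
      intro s hs
      filter_upwards [hout hs] with R hR using hR t
    refine ((hL.comp h1).div_const (p t)).congr fun R => ?_
    have := hp0 t
    simp only [Function.comp_apply]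
    field_simp

/-- 1 / p = conj p / (1 + t²), so each side of the arch contributes a multiple of ∫ dt / (1 + t²).
The factor w is the direction of that side. -/
lemma im_integral_div {L : ℝ} {p : ℝ → ℂ} (hp : Continuous p)
    (hp1 : ∀ t, Complex.normSq (p t) = 1 + t ^ 2)
    {w : ℂ} (hw : ∀ t, (w * (starRingEnd ℂ) (p t)).im = -1) (α β : ℝ) :
    (w * ∫ t in α..β, (L : ℂ) / p t).im = -L * (Real.arctan β - Real.arctan α) := by
  have hp0 : ∀ t, p t ≠ 0 := fun t h => by
    have := hp1 t
    rw [h, map_zero] at this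
    nlinarith [sq_nonneg t]
  have hc : Continuous fun t => w * ((L : ℂ) / p t) :=
    continuous_const.mul (continuous_const.div hp hp0)
  have hpt : ∀ t, (w * ((L : ℂ) / p t)).im = -L * (1 / (1 + t ^ 2)) := by
    intro t
    rw [div_eq_mul_inv, Complex.inv_def, hp1]
    have e : w * ((L : ℂ) * ((starRingEnd ℂ) (p t) * ((1 + t ^ 2 : ℝ)⁻¹ : ℝ))) =
        (L * (1 + t ^ 2)⁻¹ : ℝ) * (w * (starRingEnd ℂ) (p t)) := by push_cast; ring
    rw [e, im_ofReal_mul, hw]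
    ring
  rw [← intervalIntegral.integral_const_mul]
  have him : (∫ t in α..β, w * ((L : ℂ) / p t)).im = ∫ t in α..β, (w * ((L : ℂ) / p t)).im :=
    (imCLM.intervalIntegral_comp_comm (hc.intervalIntegrable α β)).symm
  rw [him]
  simp_rw [hpt]
  rw [intervalIntegral.integral_const_mul, integral_one_div_one_add_sq]

lemma archIntegral_eq (G : ℂ → ℂ) {R : ℝ} :
    archIntegral G R = (∫ t in (-1 : ℝ)..1, (R : ℂ) * G (R * ((t : ℂ) + I))) -
      I * (∫ t in (0 : ℝ)..1, (R : ℂ) * G (R * (1 + t * I))) +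
      I * ∫ t in (0 : ℝ)..1, (R : ℂ) * G (R * (-1 + t * I)) := by
  have key : ∀ (q : ℝ → ℂ) (p : ℝ → ℂ), (∀ t, q (R * t) = R * p t) → ∀ α β : ℝ,
      ∫ t in α..β, (R : ℂ) * G (R * p t) = ∫ x in (R * α)..(R * β), G (q x) := by
    intro q p hqp α β
    rw [intervalIntegral.integral_const_mul]
    simp_rw [← hqp]
    rw [← intervalIntegral.smul_integral_comp_mul_left, real_smul]
  rw [archIntegral, key (fun x => x + R * I) (fun t => t + I) (fun t => by push_cast; ring),
    key (fun y => R + y * I) (fun t => 1 + t * I) (fun t => by push_cast; ring),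
    key (fun y => (-R : ℝ) + y * I) (fun t => -1 + t * I) (fun t => by push_cast; ring)]
  simp

lemma tendsto_im_archIntegral (hS : IsCompact S) (hG : ContinuousOn G (ofReal '' S)ᶜ) {L : ℝ}
    (hL : Tendsto (fun z => z * G z) (cocompact ℂ) (𝓝 (L : ℂ))) :
    Tendsto (fun R => (archIntegral G R).im) atTop (𝓝 (-(Real.pi * L))) := by
  have hn : ∀ (p : ℝ → ℂ), (∀ t, Complex.normSq (p t) = 1 + t ^ 2) → ∀ t, 1 ≤ ‖p t‖ := by
    intro p hp t
    rw [Complex.norm_def, hp, Real.one_le_sqrt]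
    nlinarith [sq_nonneg t]
  have n1 : ∀ t : ℝ, Complex.normSq ((t : ℂ) + I) = 1 + t ^ 2 := fun t => by
    simp [Complex.normSq_apply]; ring
  have n2 : ∀ t : ℝ, Complex.normSq (1 + (t : ℂ) * I) = 1 + t ^ 2 := fun t => by
    simp [Complex.normSq_apply]; ring
  have n3 : ∀ t : ℝ, Complex.normSq (-1 + (t : ℂ) * I) = 1 + t ^ 2 := fun t => by
    simp [Complex.normSq_apply]; ring
  have c1 : Continuous fun t : ℝ => (t : ℂ) + I := by fun_prop
  have c2 : Continuous fun t : ℝ => 1 + (t : ℂ) * I := by fun_prop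
  have c3 : Continuous fun t : ℝ => -1 + (t : ℂ) * I := by fun_prop
  have h := ((tendsto_integral_rescaled hS hG hL c1 (hn _ n1) (-1) 1).sub
    ((tendsto_integral_rescaled hS hG hL c2 (hn _ n2) 0 1).const_mul I)).add
    ((tendsto_integral_rescaled hS hG hL c3 (hn _ n3) 0 1).const_mul I)
  simp_rw [← archIntegral_eq] at h
  have h' := (continuous_im.tendsto _).comp h
  have e1 := im_integral_div (L := L) c1 n1 (w := 1) (by simp) (-1) 1
  have e2 := im_integral_div (L := L) c2 n2 (w := -I) (by simp) 0 1
  have e3 := im_integral_div (L := L) c3 n3 (w := I) (by simp) 0 1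
  rw [one_mul] at e1
  rw [neg_mul, neg_im] at e2
  rw [add_im, sub_im, sub_eq_add_neg, e1, e2, e3] at h'
  -- The angles seen from the origin add up to π / 2 + π / 4 + π / 4 = π; the minus sign reflects
  -- the clockwise orientation of the arch.
  have hval : -L * (Real.arctan 1 - Real.arctan (-1)) + -L * (Real.arctan 1 - Real.arctan 0) +
      -L * (Real.arctan 1 - Real.arctan 0) = -(Real.pi * L) := by
    rw [Real.arctan_neg, Real.arctan_one, Real.arctan_zero]
    ring
  rw [hval] at h'
  exact h'

/-- A function that is analytic off a compact set `S` of real numbers, has imaginary part bounded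
by `M` there and is real on the real line off `S`, has residue at infinity at most `M |S| / π`. -/
lemma pi_mul_le_of_abs_im_le (hS : IsCompact S) (hd : DifferentiableOn ℂ G (ofReal '' S)ᶜ)
    {M : ℝ} (hM : ∀ z ∈ (ofReal '' S)ᶜ, |(G z).im| ≤ M)
    (hreal : ∀ x : ℝ, x ∉ S → (G x).im = 0) {L : ℝ}
    (hL : Tendsto (fun z => z * G z) (cocompact ℂ) (𝓝 (L : ℂ))) :
    Real.pi * L ≤ M * volume.real S := by
  have h1 := (tendsto_im_archIntegral hS hd.continuousOn hL).abs
  obtain ⟨r, hr⟩ := hS.isBounded.subset_ball 0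
  have h2 : ∀ᶠ R : ℝ in atTop, |(archIntegral G R).im| ≤ M * volume.real S := by
    filter_upwards [eventually_gt_atTop 0, eventually_ge_atTop r] with R hR hrR
    refine abs_im_archIntegral_le hS hd hM hreal hR fun x hx => ?_
    have h3 := hr hx
    rw [mem_ball_zero_iff, Real.norm_eq_abs] at h3
    exact abs_lt.1 (h3.trans_le hrR)
  have h3 := le_of_tendsto h1 h2
  rw [abs_neg] at h3
  exact (le_abs_self _).trans h3

end Contour

/-! ### The bound |E| / 4 for the residue of a competitor -/

section UpperBound

open Complex MeasureTheory

lemma re_one_add_div_one_sub_pos {w : ℂ} (hw : ‖w‖ < 1) : 0 < ((1 + w) / (1 - w)).re := by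
  have h1 : 1 - w ≠ 0 := fun h => by
    rw [← sub_eq_zero.1 h, norm_one] at hw
    exact lt_irrefl _ hw
  have h2 : Complex.normSq w < 1 := by
    rw [Complex.normSq_eq_norm_sq]
    exact pow_lt_one₀ (norm_nonneg _) hw two_ne_zero
  have h3 : ((1 + w) / (1 - w)).re = (1 - Complex.normSq w) / Complex.normSq (1 - w) := by
    rw [Complex.div_re, ← add_div]
    congr 1
    simp [Complex.normSq_apply]
    ring
  rw [h3]
  exact div_pos (by linarith) (Complex.normSq_pos.2 h1)

/-- The conformal map of the unit disc onto the strip `|Im ζ| < π / 2`. -/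
def stripMap (w : ℂ) : ℂ := Complex.log ((1 + w) / (1 - w))

lemma differentiableAt_stripMap {w : ℂ} (hw : ‖w‖ < 1) : DifferentiableAt ℂ stripMap w := by
  have h1 : 1 - w ≠ 0 := fun h => by
    rw [← sub_eq_zero.1 h, norm_one] at hw
    exact lt_irrefl _ hw
  refine DifferentiableAt.clog ?_ (Or.inl (re_one_add_div_one_sub_pos hw))
  exact DifferentiableAt.div (by fun_prop) (by fun_prop) h1

lemma hasDerivAt_stripMap_zero : HasDerivAt stripMap 2 0 := by
  have h1 : HasDerivAt (fun w : ℂ => 1 + w) 1 0 := (hasDerivAt_id (0 : ℂ)).const_add 1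
  have h2 : HasDerivAt (fun w : ℂ => 1 - w) (-1) 0 := (hasDerivAt_id (0 : ℂ)).const_sub 1
  have h3 := (h1.div h2 (by norm_num)).clog (by norm_num)
  have e : ((1 * (1 - 0) - (1 + 0) * -1) / (1 - 0) ^ 2 : ℂ) /
      (((fun w : ℂ => 1 + w) / fun w : ℂ => 1 - w) 0) = 2 := by
    norm_num
  rw [e] at h3
  exact h3

lemma stripMap_zero : stripMap 0 = 0 := by simp [stripMap]

lemma abs_im_stripMap_le {w : ℂ} (hw : ‖w‖ < 1) : |(stripMap w).im| ≤ Real.pi / 2 := by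
  rw [stripMap, Complex.log_im]
  exact abs_arg_le_pi_div_two_iff.2 (re_one_add_div_one_sub_pos hw).le

lemma im_stripMap_ofReal {x : ℝ} (hx : |x| < 1) : (stripMap x).im = 0 := by
  have h := abs_lt.1 hx
  rw [stripMap, Complex.log_im, ← ofReal_one, ← ofReal_add, ← ofReal_sub, ← ofReal_div,
    arg_ofReal_of_nonneg]
  exact div_nonneg (by linarith) (by linarith)

/-- Since `stripMap` vanishes at 0 with derivative 2, it doubles the residue; `dslope` expresses
this as a factorization with a continuous second factor. -/
lemma tendsto_mul_stripMap {h : ℂ → ℂ} {l : ℂ} {F : Filter ℂ} (h0 : Tendsto h F (𝓝 0))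
    (hl : Tendsto (fun z => z * h z) F (𝓝 l)) :
    Tendsto (fun z => z * stripMap (h z)) F (𝓝 (l * 2)) := by
  have hc : ContinuousAt (dslope stripMap 0) 0 :=
    continuousAt_dslope_same.2 hasDerivAt_stripMap_zero.differentiableAt
  have h1 := hl.mul (hc.tendsto.comp h0)
  rw [dslope_same, hasDerivAt_stripMap_zero.deriv] at h1
  refine h1.congr fun z => ?_
  have h2 := sub_smul_dslope stripMap 0 (h z)
  rw [stripMap_zero, sub_zero, sub_zero, smul_eq_mul] at h2
  rw [Function.comp_apply, mul_assoc, h2]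

variable {S : Set ℝ}

lemma conj_mem_image_iff {z : ℂ} : (starRingEnd ℂ) z ∈ ofReal '' S ↔ z ∈ ofReal '' S := by
  constructor
  · rintro ⟨t, ht, h⟩
    exact ⟨t, ht, by rw [← conj_conj z, ← h, conj_ofReal]⟩
  · rintro ⟨t, ht, rfl⟩
    exact ⟨t, ht, (conj_ofReal t).symm⟩

lemma tendsto_conj_cocompact : Tendsto (starRingEnd ℂ) (cocompact ℂ) (cocompact ℂ) :=
  Complex.conjCLE.toHomeomorph.isClosedEmbedding.tendsto_cocompact

/-- The symmetrization of a competitor is a competitor with real values on the real line. -/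
lemma exists_real_competitor (hS : IsCompact S) {f : ℂ → ℂ} (hf : IsCompetitor (ofReal '' S) f)
    {l : ℂ} (hl : Tendsto (fun z => z * f z) (cocompact ℂ) (𝓝 l)) :
    ∃ h : ℂ → ℂ, IsCompetitor (ofReal '' S) h ∧ (∀ x : ℝ, (h x).im = 0) ∧
      Tendsto (fun z => z * h z) (cocompact ℂ) (𝓝 (‖l‖ : ℂ)) := by
  -- A rotation makes the residue real and nonnegative, so that averaging with the reflected
  -- function preserves it.
  obtain ⟨u, hu, hul⟩ : ∃ u : ℂ, ‖u‖ = 1 ∧ u * l = ‖l‖ := by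
    by_cases hl0 : l = 0
    · exact ⟨1, by simp, by simp [hl0]⟩
    · have hn : (‖l‖ : ℂ) ≠ 0 := by simpa using hl0
      refine ⟨(starRingEnd ℂ) l / ‖l‖, ?_, ?_⟩
      · rw [norm_div, norm_conj, norm_real, norm_norm, div_self (by simpa using hl0)]
      · rw [div_mul_eq_mul_div, mul_comm, mul_conj, normSq_eq_norm_sq]
        field_simp
        push_cast
        ring
  have hopen : IsOpen (ofReal '' S)ᶜ := (hS.image continuous_ofReal).isClosed.isOpen_compl
  set p : ℂ → ℂ := fun z => u * f z with hp
  set q : ℂ → ℂ := fun z => (starRingEnd ℂ) (p ((starRingEnd ℂ) z)) with hq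
  have hpd : ∀ z ∈ (ofReal '' S)ᶜ, DifferentiableAt ℂ p z := fun z hz =>
    ((hf.differentiableOn z hz).differentiableAt (hopen.mem_nhds hz)).const_mul u
  have hpn : ∀ z ∈ (ofReal '' S)ᶜ, ‖p z‖ ≤ 1 := fun z hz => by
    rw [hp]
    simpa [hu] using hf.norm_le_one z hz
  have hconj : ∀ {z : ℂ}, z ∈ (ofReal '' S)ᶜ → (starRingEnd ℂ) z ∈ (ofReal '' S)ᶜ :=
    fun hz h => hz (conj_mem_image_iff.1 h)
  have hp0 : Tendsto p (cocompact ℂ) (𝓝 0) := by simpa using hf.tendsto_zero.const_mul u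
  have hq0 : Tendsto q (cocompact ℂ) (𝓝 0) := by
    have := (continuous_conj.tendsto 0).comp (hp0.comp tendsto_conj_cocompact)
    rwa [map_zero] at this
  have hpl : Tendsto (fun z => z * p z) (cocompact ℂ) (𝓝 (‖l‖ : ℂ)) := by
    rw [← hul]
    refine (hl.const_mul u).congr fun z => ?_
    rw [hp]; ring
  have hql : Tendsto (fun z => z * q z) (cocompact ℂ) (𝓝 (‖l‖ : ℂ)) := by
    have := (continuous_conj.tendsto _).comp (hpl.comp tendsto_conj_cocompact)
    rw [conj_ofReal] at this
    refine this.congr fun z => ?_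
    simp [hq]
  refine ⟨fun z => (p z + q z) / 2, ⟨?_, ?_, ?_⟩, ?_, ?_⟩
  · intro z hz
    refine DifferentiableAt.differentiableWithinAt (DifferentiableAt.div_const ?_ 2)
    refine (hpd z hz).add ?_
    have := (hpd _ (hconj hz)).conj_conj
    rw [conj_conj] at this
    exact this
  · intro z hz
    have h1 := hpn z hz
    have h2 := hpn _ (hconj hz)
    rw [norm_div, RCLike.norm_ofNat]
    have h3 : ‖q z‖ ≤ 1 := by rw [hq]; simpa using h2
    have := norm_add_le (p z) (q z)
    linarith
  · simpa using (hp0.add hq0).div_const 2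
  · intro x
    simp [hq]
  · have := (hpl.add hql).div_const 2
    rw [add_self_div_two] at this
    refine this.congr fun z => ?_
    ring

/-- The upper bound `|E| / 4` for the analytic capacity of a compact set of real numbers. -/
lemma norm_le_of_isCompetitor (hS : IsCompact S) {f : ℂ → ℂ}
    (hf : IsCompetitor (ofReal '' S) f) {l : ℂ}
    (hl : Tendsto (fun z => z * f z) (cocompact ℂ) (𝓝 l)) :
    ‖l‖ ≤ volume.real S / 4 := by
  obtain ⟨h, hh, hreal, hhl⟩ := exists_real_competitor hS hf hl
  -- A competitor may have modulus 1, where `stripMap` is not controlled; the factor r < 1 avoids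
  -- this and tends to 1 at the end.
  have key : ∀ r ∈ Set.Ioo (0 : ℝ) 1, r * ‖l‖ ≤ volume.real S / 4 := by
    intro r hr
    have hlt : ∀ z ∈ (ofReal '' S)ᶜ, ‖(r : ℂ) * h z‖ < 1 := by
      intro z hz
      rw [norm_mul, norm_real, Real.norm_of_nonneg hr.1.le]
      exact (mul_le_of_le_one_right hr.1.le (hh.norm_le_one z hz)).trans_lt hr.2
    have h0 : Tendsto (fun z => (r : ℂ) * h z) (cocompact ℂ) (𝓝 0) := by
      simpa using hh.tendsto_zero.const_mul (r : ℂ)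
    have hl' : Tendsto (fun z => z * ((r : ℂ) * h z)) (cocompact ℂ) (𝓝 ((r : ℂ) * ‖l‖)) :=
      (hhl.const_mul (r : ℂ)).congr fun z => by ring
    have hG : Tendsto (fun z => z * stripMap ((r : ℂ) * h z)) (cocompact ℂ)
        (𝓝 ((r * ‖l‖ * 2 : ℝ) : ℂ)) := by
      push_cast
      exact tendsto_mul_stripMap h0 hl'
    have := pi_mul_le_of_abs_im_le (G := fun z => stripMap ((r : ℂ) * h z)) hS
      (M := Real.pi / 2) ?_ (fun z hz => abs_im_stripMap_le (hlt z hz)) ?_ hG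
    · have hpi := Real.pi_pos
      have h2 : Real.pi * (r * ‖l‖ * 2) ≤ Real.pi * (volume.real S / 2) := by linarith
      linarith [le_of_mul_le_mul_left h2 hpi]
    · intro z hz
      exact DifferentiableAt.comp_differentiableWithinAt (g := stripMap) z
        (differentiableAt_stripMap (hlt z hz)) ((hh.differentiableOn z hz).const_mul (r : ℂ))
    · intro x hx
      have hx' : (x : ℂ) ∈ (ofReal '' S)ᶜ := by
        rwa [Set.mem_compl_iff, ofReal_injective.mem_set_image]
      have e : h x = ((h x).re : ℂ) := Complex.ext rfl (by simp [hreal x])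
      have h1 := hlt x hx'
      rw [e, ← ofReal_mul, norm_real, Real.norm_eq_abs] at h1
      change (stripMap ((r : ℂ) * h x)).im = 0
      rw [e, ← ofReal_mul]
      exact im_stripMap_ofReal h1
  have hlim : Tendsto (fun r : ℝ => r * ‖l‖) (𝓝[<] 1) (𝓝 (1 * ‖l‖)) :=
    ((continuous_id.mul continuous_const).tendsto 1).mono_left nhdsWithin_le_nhds
  rw [one_mul] at hlim
  exact le_of_tendsto hlim (by
    filter_upwards [Ioo_mem_nhdsLT (zero_lt_one' ℝ)] with r hr using key r hr)

end UpperBound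

/-! ### Uniqueness of the extremal function -/

section Uniqueness

open Complex

/-- The maximum principle on the exterior of a disc, infinity included: h is small outside a larger
disc, which leaves an annulus. -/
lemma norm_le_one_of_exterior {E : Set ℂ} {h : ℂ → ℂ} (hd : DifferentiableOn ℂ h Eᶜ) {ρ : ℝ}
    (hE : E ⊆ Metric.ball 0 ρ) (h0 : Tendsto h (cocompact ℂ) (𝓝 0))
    (hρ : ∀ z : ℂ, ‖z‖ = ρ → ‖h z‖ ≤ 1) {z : ℂ} (hz : ρ ≤ ‖z‖) : ‖h z‖ ≤ 1 := by
  have hev : ∀ᶠ w in cocompact ℂ, ‖h w‖ ≤ 1 := by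
    have := h0.norm
    rw [norm_zero] at this
    exact this.eventually_le_const zero_lt_one
  rw [← Metric.cobounded_eq_cocompact] at hev
  obtain ⟨r, -, hr⟩ := (hasBasis_cobounded_norm (E := ℂ)).mem_iff.1 hev
  by_cases hzr : r ≤ ‖z‖
  · exact hr hzr
  rcases hz.eq_or_lt with hz | hz
  · exact hρ z hz.symm
  set U : Set ℂ := Metric.ball 0 r ∩ (Metric.closedBall 0 ρ)ᶜ with hU
  have hUo : IsOpen U := Metric.isOpen_ball.inter Metric.isClosed_closedBall.isOpen_compl
  have hcl : closure U ⊆ Metric.closedBall 0 r ∩ (Metric.ball 0 ρ)ᶜ :=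
    closure_minimal (Set.inter_subset_inter Metric.ball_subset_closedBall
      (Set.compl_subset_compl.2 Metric.ball_subset_closedBall))
      (Metric.isClosed_closedBall.inter Metric.isOpen_ball.isClosed_compl)
  have hdc : DiffContOnCl ℂ h U :=
    (hd.mono (hcl.trans fun w hw hwE => hw.2 (hE hwE))).diffContOnCl
  refine norm_le_of_forall_mem_frontier_norm_le (Metric.isBounded_ball.subset Set.inter_subset_left)
    hdc ?_ (subset_closure (s := U) ⟨by simpa using hzr, by simpa using hz⟩)
  intro w hw
  rw [hUo.frontier_eq] at hw
  have h1 := (hcl hw.1).2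
  rw [Set.mem_compl_iff, mem_ball_zero_iff, not_lt] at h1
  rcases h1.eq_or_lt with h1 | h1
  · exact hρ w h1.symm
  · refine hr (not_lt.1 fun h2 => hw.2 ⟨by simpa using h2, by simpa using h1⟩)

/-- By the parallelogram law, x = |(p + q) / 2| and y = |(p - q) / 2| satisfy x² + y² ≤ 1; then use
x ≤ (1 + x²) / 2. The term y² / 2 is the room for a perturbation of the midpoint. -/
lemma norm_half_add_sq_le {p q : ℂ} (hp : ‖p‖ ≤ 1) (hq : ‖q‖ ≤ 1) :
    ‖(p + q) / 2‖ + ‖(p - q) / 2‖ ^ 2 / 2 ≤ 1 := by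
  have hpar := parallelogram_law_with_norm ℝ p q
  have e1 : ‖(p + q) / 2‖ = ‖p + q‖ / 2 := by rw [norm_div, RCLike.norm_ofNat]
  have e2 : ‖(p - q) / 2‖ = ‖p - q‖ / 2 := by rw [norm_div, RCLike.norm_ofNat]
  rw [e1, e2]
  have h1 : ‖p‖ ^ 2 ≤ 1 := pow_le_one₀ (norm_nonneg _) hp
  have h2 : ‖q‖ ^ 2 ≤ 1 := pow_le_one₀ (norm_nonneg _) hq
  nlinarith [sq_nonneg (‖p + q‖ / 2 - 1)]

/-- In the coordinate w = 1 / z the singularity at infinity is removable, and a function that is not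
locally zero has a zero of finite order; the order is at least 1 because k vanishes at infinity. -/
lemma exists_pow_mul_tendsto {E : Set ℂ} (hE : IsCompact E) {k : ℂ → ℂ}
    (hd : DifferentiableOn ℂ k Eᶜ) (h0 : Tendsto k (cocompact ℂ) (𝓝 0))
    (hne : ¬ ∀ᶠ z in cocompact ℂ, k z = 0) :
    ∃ (m : ℕ) (c : ℂ), c ≠ 0 ∧ Tendsto (fun z => z ^ (m + 1) * k z) (cocompact ℂ) (𝓝 c) := by
  have hinv : Tendsto (fun w : ℂ => w⁻¹) (𝓝[≠] 0) (cocompact ℂ) := by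
    rw [← Metric.cobounded_eq_cocompact]
    exact tendsto_inv₀_nhdsNE_zero
  have hinv' : Tendsto (fun z : ℂ => z⁻¹) (cocompact ℂ) (𝓝[≠] 0) := by
    rw [← Metric.cobounded_eq_cocompact]
    exact tendsto_inv₀_cobounded'
  set K : ℂ → ℂ := Function.update (fun w => k w⁻¹) 0 0 with hK
  have hKinv : ∀ z : ℂ, z ≠ 0 → K z⁻¹ = k z := fun z hz => by
    rw [hK, Function.update_of_ne (inv_ne_zero hz), inv_inv]
  have hopen : IsOpen Eᶜ := hE.isClosed.isOpen_compl
  have hKa : AnalyticAt ℂ K 0 := by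
    refine analyticAt_of_differentiable_on_punctured_nhds_of_continuousAt ?_ ?_
    · filter_upwards [hinv hE.compl_mem_cocompact, self_mem_nhdsWithin] with w hw hw0
      have h1 : DifferentiableAt ℂ (fun w => k w⁻¹) w :=
        ((hd _ hw).differentiableAt (hopen.mem_nhds hw)).comp w (differentiableAt_inv hw0)
      refine h1.congr_of_eventuallyEq ?_
      filter_upwards [isOpen_ne.mem_nhds hw0] with v hv
      rw [hK, Function.update_of_ne hv]
    · rw [hK, continuousAt_update_same]
      exact h0.comp hinv
  have hKne : ¬ ∀ᶠ w in 𝓝 0, K w = 0 := by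
    intro h
    apply hne
    filter_upwards [hinv'.eventually (h.filter_mono nhdsWithin_le_nhds),
      eventually_cocompact_ne 0] with z hz hz0
    rwa [hKinv z hz0] at hz
  obtain ⟨n, φ, hφ, hφ0, hφK⟩ := hKa.exists_eventuallyEq_pow_smul_nonzero_iff.2 hKne
  have hn : n ≠ 0 := by
    rintro rfl
    have := hφK.self_of_nhds
    rw [hK, Function.update_self] at this
    simp at this
    exact hφ0 this.symm
  obtain ⟨m, rfl⟩ := Nat.exists_eq_succ_of_ne_zero hn
  refine ⟨m, φ 0, hφ0, ?_⟩
  refine ((hφ.continuousAt.tendsto.mono_left nhdsWithin_le_nhds).comp hinv').congr' ?_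
  filter_upwards [hinv'.eventually (hφK.filter_mono nhdsWithin_le_nhds),
    eventually_cocompact_ne 0] with z hz hz0
  rw [hKinv z hz0, sub_zero, smul_eq_mul] at hz
  rw [hz, Function.comp_apply, inv_pow, ← mul_assoc, mul_inv_cancel₀ (pow_ne_zero _ hz0), one_mul]

/-- The identity theorem is applied in the two open half planes, which are convex and reach outside
every disc. Real points off S follow by continuity, so connectedness of the complement of S is not
needed. -/
lemma eqOn_zero_of_eventually_zero {S : Set ℝ} (hS : IsCompact S) {k : ℂ → ℂ}
    (hd : DifferentiableOn ℂ k (ofReal '' S)ᶜ) (hk : ∀ᶠ z in cocompact ℂ, k z = 0) :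
    ∀ z ∈ (ofReal '' S)ᶜ, k z = 0 := by
  have hopen : IsOpen (ofReal '' S)ᶜ := (hS.image continuous_ofReal).isClosed.isOpen_compl
  rw [← Metric.cobounded_eq_cocompact] at hk
  obtain ⟨r, -, hr⟩ := (hasBasis_cobounded_norm (E := ℂ)).mem_iff.1 hk
  have hnhds : ∀ z : ℂ, r < ‖z‖ → k =ᶠ[𝓝 z] 0 := fun z hz => by
    filter_upwards [continuous_norm.continuousAt.eventually_const_lt hz] with w hw
    exact hr hw.le
  have hhalf : ∀ U : Set ℂ, IsOpen U → Convex ℝ U → U ⊆ (ofReal '' S)ᶜ → ∀ z₀ ∈ U, r < ‖z₀‖ →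
      ∀ z ∈ U, k z = 0 := by
    intro U hUo hUc hUS z₀ hz₀ hrz z hz
    exact ((hd.mono hUS).analyticOnNhd hUo).eqOn_zero_of_preconnected_of_eventuallyEq_zero
      hUc.isPreconnected hz₀ (hnhds z₀ hrz) hz
  have hup : ∀ z : ℂ, 0 < z.im → k z = 0 := by
    refine hhalf {z | 0 < z.im} (isOpen_lt continuous_const continuous_im)
      (convex_halfSpace_im_gt 0) ?_ ((|r| + 1 : ℝ) * I) ?_ ?_
    · rintro z hz ⟨t, -, rfl⟩
      simp at hz
    · simp; positivity
    · rw [norm_mul, norm_I, mul_one, norm_real, Real.norm_of_nonneg (by positivity)]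
      linarith [le_abs_self r]
  have hdown : ∀ z : ℂ, z.im < 0 → k z = 0 := by
    refine hhalf {z | z.im < 0} (isOpen_lt continuous_im continuous_const)
      (convex_halfSpace_im_lt 0) ?_ ((-(|r| + 1) : ℝ) * I) ?_ ?_
    · rintro z hz ⟨t, -, rfl⟩
      simp at hz
    · simp
      linarith [abs_nonneg r]
    · rw [norm_mul, norm_I, mul_one, norm_real, norm_neg, Real.norm_of_nonneg (by positivity)]
      linarith [le_abs_self r]
  intro z hz
  rcases lt_trichotomy z.im 0 with h | h | h
  · exact hdown z h
  · have hc : ContinuousAt k z := (hd z hz).differentiableAt (hopen.mem_nhds hz) |>.continuousAt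
    have hpath : Tendsto (fun ε : ℝ => z + ε * I) (𝓝[>] 0) (𝓝 z) := by
      have : Continuous fun ε : ℝ => z + ε * I := by fun_prop
      simpa using (this.tendsto 0).mono_left (nhdsWithin_le_nhds (s := Set.Ioi 0))
    refine tendsto_nhds_unique (hc.tendsto.comp hpath) (tendsto_const_nhds.congr' ?_)
    filter_upwards [self_mem_nhdsWithin] with ε hε
    refine (hup _ ?_).symm
    simpa [h] using hε
  · exact hup z h

/-- Two extremal functions with the same residue at infinity agree. -/
lemma extremal_unique {S : Set ℝ} (hS : IsCompact S) {f₁ f₂ : ℂ → ℂ} {γ : ℝ} (hγ : 0 < γ)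
    (h₁ : IsCompetitor (ofReal '' S) f₁) (h₂ : IsCompetitor (ofReal '' S) f₂)
    (hl₁ : Tendsto (fun z => z * f₁ z) (cocompact ℂ) (𝓝 (γ : ℂ)))
    (hl₂ : Tendsto (fun z => z * f₂ z) (cocompact ℂ) (𝓝 (γ : ℂ)))
    (hmax : ∀ f : ℂ → ℂ, IsCompetitor (ofReal '' S) f →
      ∀ l : ℂ, Tendsto (fun z => z * f z) (cocompact ℂ) (𝓝 l) → ‖l‖ ≤ γ) :
    ∀ z ∈ (ofReal '' S)ᶜ, f₁ z = f₂ z := by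
  set E : Set ℂ := ofReal '' S with hEdef
  have hE : IsCompact E := hS.image continuous_ofReal
  set k : ℂ → ℂ := fun z => (f₁ z - f₂ z) / 2 with hk
  set f : ℂ → ℂ := fun z => (f₁ z + f₂ z) / 2 with hf
  have hkd : DifferentiableOn ℂ k Eᶜ := (h₁.differentiableOn.sub h₂.differentiableOn).div_const 2
  have hfd : DifferentiableOn ℂ f Eᶜ := (h₁.differentiableOn.add h₂.differentiableOn).div_const 2
  have hk0 : Tendsto k (cocompact ℂ) (𝓝 0) := by
    simpa using (h₁.tendsto_zero.sub h₂.tendsto_zero).div_const 2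
  have hf0 : Tendsto f (cocompact ℂ) (𝓝 0) := by
    simpa using (h₁.tendsto_zero.add h₂.tendsto_zero).div_const 2
  have hfl : Tendsto (fun z => z * f z) (cocompact ℂ) (𝓝 (γ : ℂ)) := by
    have := (hl₁.add hl₂).div_const 2
    rw [add_self_div_two] at this
    exact this.congr fun z => by rw [hf]; ring
  suffices hkz : ∀ z ∈ Eᶜ, k z = 0 by
    intro z hz
    have := hkz z hz
    rw [hk] at this
    simpa [sub_eq_zero] using this
  refine eqOn_zero_of_eventually_zero hS hkd ?_
  by_contra hne
  obtain ⟨m, c, hc, hcl⟩ := exists_pow_mul_tendsto hE hkd hk0 hne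
  obtain ⟨ρ, hρ0, hρ⟩ := hE.isBounded.subset_ball_lt 0 0
  -- Chosen so that |v| ≤ |k|² / 2 on |z| ≤ ρ off E.
  set ε : ℝ := (2 * (‖c‖ ^ 2 * ρ ^ (2 * m + 1) + 1))⁻¹ with hε
  have hε0 : 0 < ε := by positivity
  -- Since k ~ c z^{-(m+1)}, the power z^{2m+1} leaves k² with a simple zero at infinity, and
  -- conj(c)² makes the residue ε |c|⁴ positive. The bound on f + v is proved for |z| ≤ ρ and
  -- extended by the maximum principle.
  set v : ℂ → ℂ := fun z => (ε : ℂ) * (starRingEnd ℂ) c ^ 2 * z ^ (2 * m + 1) * k z ^ 2 with hv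
  have hpert : Tendsto (fun z => z * v z) (cocompact ℂ) (𝓝 ((ε * ‖c‖ ^ 4 : ℝ) : ℂ)) := by
    have h3 := (hcl.pow 2).const_mul ((ε : ℂ) * (starRingEnd ℂ) c ^ 2)
    have e : ((ε * ‖c‖ ^ 4 : ℝ) : ℂ) = (ε : ℂ) * (starRingEnd ℂ) c ^ 2 * c ^ 2 := by
      have : (starRingEnd ℂ) c * c = (‖c‖ ^ 2 : ℝ) := by
        rw [mul_comm, mul_conj, normSq_eq_norm_sq]
      rw [mul_assoc, ← mul_pow, this]
      push_cast
      ring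
    rw [e]
    exact h3.congr fun z => by rw [hv]; ring
  have hv0 : Tendsto v (cocompact ℂ) (𝓝 0) := by
    have h3 := hpert.mul tendsto_inv_cocompact
    rw [mul_zero] at h3
    refine h3.congr' ?_
    filter_upwards [eventually_cocompact_ne 0] with z hz
    field_simp
  have hd : DifferentiableOn ℂ (fun z => f z + v z) Eᶜ := by
    refine hfd.add (DifferentiableOn.mul ?_ (hkd.pow 2))
    exact (Differentiable.differentiableOn (by fun_prop))
  have h0 : Tendsto (fun z => f z + v z) (cocompact ℂ) (𝓝 0) := by simpa using hf0.add hv0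
  have hin : ∀ z ∈ Eᶜ, ‖z‖ ≤ ρ → ‖f z + v z‖ ≤ 1 := by
    intro z hz hzρ
    have h3 := norm_half_add_sq_le (h₁.norm_le_one z hz) (h₂.norm_le_one z hz)
    have h4 : ‖v z‖ ≤ ‖k z‖ ^ 2 / 2 := by
      have h5 : ‖v z‖ = ε * (‖c‖ ^ 2 * ‖z‖ ^ (2 * m + 1)) * ‖k z‖ ^ 2 := by
        rw [hv]
        simp only [norm_mul, norm_pow, norm_real, norm_conj, Real.norm_of_nonneg hε0.le]
        ring
      have h6 : ε * (‖c‖ ^ 2 * ‖z‖ ^ (2 * m + 1)) ≤ 1 / 2 := by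
        have h7 : ‖c‖ ^ 2 * ‖z‖ ^ (2 * m + 1) ≤ ‖c‖ ^ 2 * ρ ^ (2 * m + 1) + 1 := by
          have : ‖z‖ ^ (2 * m + 1) ≤ ρ ^ (2 * m + 1) := pow_le_pow_left₀ (norm_nonneg _) hzρ _
          nlinarith [sq_nonneg ‖c‖]
        refine (mul_le_mul_of_nonneg_left h7 hε0.le).trans (le_of_eq ?_)
        rw [hε]
        have : ‖c‖ ^ 2 * ρ ^ (2 * m + 1) + 1 ≠ 0 := by positivity
        field_simp
      rw [h5]
      nlinarith [mul_le_mul_of_nonneg_right h6 (sq_nonneg ‖k z‖)]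
    exact (norm_add_le _ _).trans (by linarith)
  have hout : ∀ z : ℂ, ‖z‖ = ρ → z ∈ Eᶜ := fun z hz hzE => by
    have := hρ hzE
    rw [mem_ball_zero_iff] at this
    linarith
  have hcomp : IsCompetitor E fun z => f z + v z := by
    refine ⟨hd, fun z hz => ?_, h0⟩
    rcases le_total ‖z‖ ρ with h | h
    · exact hin z hz h
    · exact norm_le_one_of_exterior hd hρ h0 (fun w hw => hin w (hout w hw) hw.le) h
  have hlim : Tendsto (fun z => z * (f z + v z)) (cocompact ℂ)
      (𝓝 ((γ + ε * ‖c‖ ^ 4 : ℝ) : ℂ)) := by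
    have := hfl.add hpert
    rw [← ofReal_add] at this
    exact this.congr fun z => by ring
  have h3 := hmax _ hcomp _ hlim
  have h4 : 0 < ε * ‖c‖ ^ 4 := by positivity
  rw [norm_real, Real.norm_of_nonneg (by positivity)] at h3
  linarith

end Uniqueness

/-! ### One-sided neighbourhoods of points of the gap set -/

section Neighbours

variable {g : ℕ} {a b : Fin (g + 1) → ℝ}

/-- The a j are the right ends of the bands and the b j the left ends; the four lemmas here say that
these are the only points where E stops on that side. -/
lemma eventually_right_not_mem (hab : IsGapData a b) (j : Fin (g + 1)) :
    ∀ᶠ y in 𝓝[>] a j, y ∉ realGapSet a b := by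
  refine Fin.cases ?_ (fun j => ?_) j
  · filter_upwards [self_mem_nhdsWithin] with y hy hyS
    exact not_lt.2 hyS.1.2 hy
  · filter_upwards [Ioo_mem_nhdsGT (hab.lt_right j)] with y hy hyS
    exact hyS.2 (Set.mem_iUnion.2 ⟨j, hy⟩)

lemma eventually_left_not_mem (hab : IsGapData a b) (j : Fin (g + 1)) :
    ∀ᶠ y in 𝓝[<] b j, y ∉ realGapSet a b := by
  refine Fin.cases ?_ (fun j => ?_) j
  · filter_upwards [self_mem_nhdsWithin] with y hy hyS
    exact not_lt.2 hyS.1.1 hy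
  · filter_upwards [Ioo_mem_nhdsLT (hab.lt_right j)] with y hy hyS
    exact hyS.2 (Set.mem_iUnion.2 ⟨j, hy⟩)

lemma eventually_right_mem {x : ℝ} (hx : x ∈ realGapSet a b) (hxa : ∀ j, x ≠ a j) :
    ∀ᶠ y in 𝓝[>] x, y ∈ realGapSet a b := by
  have h0 : x < a 0 := lt_of_le_of_ne hx.1.2 (hxa 0)
  have hj : ∀ᶠ y in 𝓝[>] x, ∀ j : Fin g, y ∉ Set.Ioo (a j.succ) (b j.succ) := by
    rw [eventually_all]
    intro j
    rcases lt_or_ge x (a j.succ) with h | h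
    · filter_upwards [Ioo_mem_nhdsGT h] with y hy hy'
      exact lt_asymm hy.2 hy'.1
    · have h1 : b j.succ ≤ x := not_lt.1 fun h' =>
        hx.2 (Set.mem_iUnion.2 ⟨j, lt_of_le_of_ne h (hxa _).symm, h'⟩)
      filter_upwards [self_mem_nhdsWithin] with y hy hy'
      exact lt_asymm (h1.trans_lt hy) hy'.2
  filter_upwards [hj, Ioo_mem_nhdsGT h0] with y hy hy0
  exact ⟨⟨hx.1.1.trans hy0.1.le, hy0.2.le⟩, fun h => by
    obtain ⟨j, h⟩ := Set.mem_iUnion.1 h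
    exact hy j h⟩

lemma eventually_left_mem {x : ℝ} (hx : x ∈ realGapSet a b) (hxb : ∀ j, x ≠ b j) :
    ∀ᶠ y in 𝓝[<] x, y ∈ realGapSet a b := by
  have h0 : b 0 < x := lt_of_le_of_ne hx.1.1 (hxb 0).symm
  have hj : ∀ᶠ y in 𝓝[<] x, ∀ j : Fin g, y ∉ Set.Ioo (a j.succ) (b j.succ) := by
    rw [eventually_all]
    intro j
    rcases lt_or_ge (b j.succ) x with h | h
    · filter_upwards [Ioo_mem_nhdsLT h] with y hy hy'
      exact lt_asymm hy.1 hy'.2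
    · have h1 : x ≤ a j.succ := not_lt.1 fun h' =>
        hx.2 (Set.mem_iUnion.2 ⟨j, h', lt_of_le_of_ne h (hxb _)⟩)
      filter_upwards [self_mem_nhdsWithin] with y hy hy'
      exact lt_asymm (lt_of_lt_of_le hy h1) hy'.1
  filter_upwards [hj, Ioo_mem_nhdsLT h0] with y hy hy0
  exact ⟨⟨hy0.1.le, hy0.2.le.trans hx.1.2⟩, fun h => by
    obtain ⟨j, h⟩ := Set.mem_iUnion.1 h
    exact hy j h⟩

lemma infinite_realGapSet (hab : IsGapData a b) : (realGapSet a b).Infinite := by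
  have h := eventually_right_mem (right_mem_realGapSet hab 0)
    fun j => (left_ne_right hab j 0).symm
  obtain ⟨u, hu, hsub⟩ := (mem_nhdsGT_iff_exists_Ioo_subset).1 h
  exact (Set.Ioo_infinite hu).mono hsub

end Neighbours

/-! ### Rigidity of Herglotz rational functions -/

section Rigidity

open Polynomial

lemma sphereEval_eq_coe_iff (R : RatFunc ℂ) (z t : ℂ) :
    sphereEval R z = (t : OnePoint ℂ) ↔ R.denom.eval z ≠ 0 ∧ R.num.eval z / R.denom.eval z = t := by
  rw [sphereEval, RatFunc.eval, eval₂_id, eval₂_id]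
  by_cases h : R.denom.eval z = 0
  · simp [h]
  · simp [h]

lemma num_eval_ne_zero_of_denom_eval_eq_zero (R : RatFunc ℂ) {z : ℂ} (h : R.denom.eval z = 0) :
    R.num.eval z ≠ 0 := by
  intro h'
  obtain ⟨u, v, huv⟩ := R.isCoprime_num_denom
  have := congrArg (eval z) huv
  simp [h, h'] at this

/-- A rational function that has real values on an infinite set of real numbers is real on the
real line. -/
lemma im_eval_eq_zero (R : RatFunc ℂ) {S : Set ℝ} (hS : S.Infinite)
    (h : ∀ x ∈ S, (R.num.eval (x : ℂ) / R.denom.eval (x : ℂ)).im = 0) (x : ℝ) :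
    (R.num.eval (x : ℂ) / R.denom.eval (x : ℂ)).im = 0 := by
  have hconj : ∀ (P : ℂ[X]) (y : ℝ),
      (P.map (starRingEnd ℂ)).eval (y : ℂ) = (starRingEnd ℂ) (P.eval (y : ℂ)) := by
    intro P y
    conv_lhs => rw [← Complex.conj_ofReal y]
    rw [eval_map, eval₂_hom]
  have him : ∀ u v : ℂ, (u / v).im = 0 ↔ u * (starRingEnd ℂ) v - (starRingEnd ℂ) u * v = 0 := by
    intro u v
    by_cases hv : v = 0
    · simp [hv]
    · have hv' : (starRingEnd ℂ) v ≠ 0 := by simpa using hv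
      rw [← Complex.conj_eq_iff_im, map_div₀, div_eq_div_iff hv' hv, sub_eq_zero, eq_comm]
  set P : ℂ[X] := R.num * R.denom.map (starRingEnd ℂ) - R.num.map (starRingEnd ℂ) * R.denom
    with hP
  have hPe : ∀ y : ℝ, P.eval (y : ℂ) = R.num.eval (y : ℂ) * (starRingEnd ℂ) (R.denom.eval (y : ℂ)) -
      (starRingEnd ℂ) (R.num.eval (y : ℂ)) * R.denom.eval (y : ℂ) := fun y => by
    rw [hP, eval_sub, eval_mul, eval_mul, hconj, hconj]
  have hP0 : P = 0 := by
    -- P expresses the reality of num / denom on the real line as a polynomial identity. At a real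
    -- pole the quotient is 0 by convention, so the conclusion holds for every real x.
    refine eq_zero_of_infinite_isRoot P ((hS.image Complex.ofReal_injective.injOn).mono ?_)
    rintro _ ⟨y, hy, rfl⟩
    exact (hPe y).trans ((him _ _).1 (h y hy))
  rw [him, ← hPe, hP0, eval_zero]

/-- Approach x₀ along x₀ + r u with r → 0⁺; the positive factor r ^ m drops out, and the strict
inequality becomes a weak one in the limit. -/
lemma nonneg_im_pow_mul {P Q : ℂ[X]} {x₀ : ℝ} {m : ℕ}
    (hpos : ∀ z : ℂ, 0 < z.im → Q.eval z ≠ 0 →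
      0 < ((z - x₀) ^ m * (P.eval z / Q.eval z)).im)
    (hQ : Q.eval (x₀ : ℂ) ≠ 0) {u : ℂ} (hu : 0 < u.im) :
    0 ≤ (u ^ m * (P.eval (x₀ : ℂ) / Q.eval (x₀ : ℂ))).im := by
  have hpath : Tendsto (fun r : ℝ => (x₀ : ℂ) + r * u) (𝓝[>] 0) (𝓝 x₀) := by
    have : Continuous fun r : ℝ => (x₀ : ℂ) + r * u := by fun_prop
    simpa using (this.tendsto 0).mono_left (nhdsWithin_le_nhds (s := Set.Ioi 0))
  have h1 : Tendsto (fun z : ℂ => P.eval z / Q.eval z) (𝓝 x₀)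
      (𝓝 (P.eval (x₀ : ℂ) / Q.eval (x₀ : ℂ))) :=
    (P.continuous.tendsto _).div (Q.continuous.tendsto _) hQ
  have h2 := (Complex.continuous_im.tendsto _).comp ((h1.comp hpath).const_mul (u ^ m))
  refine ge_of_tendsto h2 ?_
  filter_upwards [self_mem_nhdsWithin,
    hpath.eventually ((Q.continuous.tendsto _).eventually_ne hQ)] with r hr hQr
  have hr' : (0 : ℝ) < r := hr
  have h3 := hpos (x₀ + r * u) (by simpa using mul_pos hr' hu) hQr
  have e : ((x₀ : ℂ) + r * u - x₀) ^ m * (P.eval ((x₀ : ℂ) + r * u) / Q.eval ((x₀ : ℂ) + r * u)) =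
      (r ^ m : ℝ) * (u ^ m * (P.eval ((x₀ : ℂ) + r * u) / Q.eval ((x₀ : ℂ) + r * u))) := by
    push_cast
    ring
  rw [e, Complex.im_ofReal_mul] at h3
  exact (pos_of_mul_pos_right h3 (by positivity)).le

lemma exp_pi_mul_I_pow {m : ℕ} (hm : m ≠ 0) (k : ℝ) :
    Complex.exp ((k * Real.pi / (2 * m) : ℝ) * Complex.I) ^ m =
      Complex.exp ((k * Real.pi / 2 : ℝ) * Complex.I) := by
  rw [← Complex.exp_nat_mul]
  congr 1
  push_cast
  have : (m : ℂ) ≠ 0 := Nat.cast_ne_zero.2 hm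
  field_simp

/-- A real value is taken by a Herglotz function on the real line with multiplicity one and
positive derivative. -/
lemma multiplicity_eq_one_and_pos {m : ℕ} (hm : m ≠ 0) {c : ℂ} (hc0 : c ≠ 0) (hc : c.im = 0)
    (h : ∀ u : ℂ, 0 < u.im → 0 ≤ (u ^ m * c).im) : m = 1 ∧ 0 < c.re := by
  have hpi := Real.pi_pos
  have him : ∀ k : ℝ, 0 < k → k < 2 * m →
      0 < (Complex.exp ((k * Real.pi / (2 * m) : ℝ) * Complex.I)).im := by
    intro k hk hkm
    rw [Complex.exp_ofReal_mul_I_im]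
    have hm0 : (0 : ℝ) < 2 * m := hk.trans hkm
    refine Real.sin_pos_of_pos_of_lt_pi (by positivity) ?_
    rw [div_lt_iff₀ hm0]
    nlinarith
  have hm1 : (1 : ℝ) ≤ m := by exact_mod_cast Nat.one_le_iff_ne_zero.2 hm
  -- The direction u = exp(iπ / 2m) has u ^ m = i, whence Re c ≥ 0.
  have h1 := h _ (him 1 one_pos (by linarith))
  rw [exp_pi_mul_I_pow hm, one_mul] at h1
  push_cast at h1
  rw [Complex.exp_pi_div_two_mul_I, Complex.I_mul_im] at h1
  have hre : c.re ≠ 0 := fun h0 => hc0 (Complex.ext h0 hc)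
  refine ⟨?_, lt_of_le_of_ne h1 hre.symm⟩
  by_contra hne
  have hm2 : (2 : ℝ) ≤ m := by exact_mod_cast (by omega : 2 ≤ m)
  -- For m ≥ 2 also exp(3iπ / 2m) lies in the upper half plane; its m-th power is -i, whence Re c ≤
  -- 0, a contradiction.
  have h3 := h _ (him 3 (by norm_num) (by linarith))
  rw [exp_pi_mul_I_pow hm] at h3
  have e : Complex.exp ((3 * Real.pi / 2 : ℝ) * Complex.I) = -Complex.I := by
    have : ((3 * Real.pi / 2 : ℝ) : ℂ) * Complex.I =
        Real.pi * Complex.I + Real.pi / 2 * Complex.I := by push_cast; ring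
    rw [this, Complex.exp_add, Complex.exp_pi_mul_I, Complex.exp_pi_div_two_mul_I, neg_one_mul]
  rw [e, neg_mul, Complex.neg_im, Complex.I_mul_im] at h3
  exact hre (le_antisymm (by linarith) h1)

/-- Near a real point where a Herglotz rational function has the real value `t`, the function is
real and increasing through `t`, and the point is a simple zero of the function minus `t`. -/
lemma herglotz_local (R : RatFunc ℂ) (hR : IsHerglotz R)
    (hreal : ∀ x : ℝ, (R.num.eval (x : ℂ) / R.denom.eval (x : ℂ)).im = 0) {t x₀ : ℝ}
    (hP0 : R.num - C (t : ℂ) * R.denom ≠ 0)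
    (hroot : (R.num - C (t : ℂ) * R.denom).eval (x₀ : ℂ) = 0) :
    (R.num - C (t : ℂ) * R.denom).rootMultiplicity (x₀ : ℂ) = 1 ∧
      ∀ᶠ x : ℝ in 𝓝 x₀, R.denom.eval (x : ℂ) ≠ 0 ∧ ∃ s : ℝ, 0 < s ∧
        R.num.eval (x : ℂ) / R.denom.eval (x : ℂ) = ((t + (x - x₀) * s : ℝ) : ℂ) := by
  set P := R.num - C (t : ℂ) * R.denom with hP
  obtain ⟨Q, hQ, hQdvd⟩ := exists_eq_pow_rootMultiplicity_mul_and_not_dvd P hP0 (x₀ : ℂ)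
  set m := P.rootMultiplicity (x₀ : ℂ) with hm
  have hm0 : m ≠ 0 := (rootMultiplicity_pos hP0).2 hroot |>.ne'
  have hD : R.denom.eval (x₀ : ℂ) ≠ 0 := by
    intro h
    refine num_eval_ne_zero_of_denom_eval_eq_zero R h ?_
    rw [hP, eval_sub, eval_mul, h, mul_zero, sub_zero] at hroot
    exact hroot
  have hQ0 : Q.eval (x₀ : ℂ) ≠ 0 := fun h => hQdvd (dvd_iff_isRoot.2 h)
  have hfac : ∀ z : ℂ, R.denom.eval z ≠ 0 → (z - x₀) ^ m * (Q.eval z / R.denom.eval z) =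
      R.num.eval z / R.denom.eval z - t := by
    intro z hz
    have h1 := congrArg (eval z) hQ
    rw [hP, eval_sub, eval_mul, eval_C, eval_mul, eval_pow, eval_sub, eval_X, eval_C] at h1
    field_simp
    linear_combination -h1
  set c := Q.eval (x₀ : ℂ) / R.denom.eval (x₀ : ℂ) with hc
  have hc0 : c ≠ 0 := div_ne_zero hQ0 hD
  have hcont : Tendsto (fun x : ℝ => Q.eval (x : ℂ) / R.denom.eval (x : ℂ)) (𝓝 x₀) (𝓝 c) :=
    ((Q.continuous.comp Complex.continuous_ofReal).tendsto x₀).div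
      ((R.denom.continuous.comp Complex.continuous_ofReal).tendsto x₀) hD
  have hDev : ∀ᶠ x : ℝ in 𝓝 x₀, R.denom.eval (x : ℂ) ≠ 0 :=
    ((R.denom.continuous.comp Complex.continuous_ofReal).tendsto x₀).eventually_ne hD
  have hqreal : ∀ x : ℝ, x ≠ x₀ → R.denom.eval (x : ℂ) ≠ 0 →
      (Q.eval (x : ℂ) / R.denom.eval (x : ℂ)).im = 0 := by
    intro x hx hx'
    have h1 := congrArg Complex.im (hfac x hx')
    rw [← Complex.ofReal_sub, ← Complex.ofReal_pow, Complex.im_ofReal_mul, Complex.sub_im, hreal,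
      Complex.ofReal_im, sub_zero] at h1
    exact (mul_eq_zero.1 h1).resolve_left (pow_ne_zero _ (sub_ne_zero.2 hx))
  have hcim : c.im = 0 := by
    have h1 := (Complex.continuous_im.tendsto c).comp
      (hcont.mono_left (nhdsWithin_le_nhds (s := {x₀}ᶜ)))
    refine tendsto_nhds_unique h1 (tendsto_const_nhds.congr' ?_)
    filter_upwards [self_mem_nhdsWithin, hDev.filter_mono nhdsWithin_le_nhds] with x hx hx'
    exact (hqreal x hx hx').symm
  have hdir : ∀ u : ℂ, 0 < u.im → 0 ≤ (u ^ m * c).im := by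
    intro u hu
    refine nonneg_im_pow_mul (fun z hz hz' => ?_) hD hu
    rw [hfac z hz', Complex.sub_im, Complex.ofReal_im, sub_zero]
    have := hR z hz hz'
    rwa [RatFunc.eval, eval₂_id, eval₂_id] at this
  obtain ⟨hm1, hcpos⟩ := multiplicity_eq_one_and_pos hm0 hc0 hcim hdir
  refine ⟨hm1, ?_⟩
  have hpos : ∀ᶠ x : ℝ in 𝓝 x₀, 0 < (Q.eval (x : ℂ) / R.denom.eval (x : ℂ)).re :=
    ((Complex.continuous_re.tendsto c).comp hcont).eventually_const_lt hcpos
  filter_upwards [hDev, hpos] with x hx hx'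
  refine ⟨hx, _, hx', ?_⟩
  have h1 := hfac x hx
  rw [hm1, pow_one] at h1
  have him : (Q.eval (x : ℂ) / R.denom.eval (x : ℂ)).im = 0 := by
    by_cases hxx : x = x₀
    · rw [hxx]; exact hcim
    · exact hqreal x hxx hx
  have e : (((Q.eval (x : ℂ) / R.denom.eval (x : ℂ)).re : ℝ) : ℂ) =
      Q.eval (x : ℂ) / R.denom.eval (x : ℂ) := Complex.ext rfl (by rw [him, Complex.ofReal_im])
  push_cast
  rw [e, h1]
  ring

lemma degree_denom_lt_of_hasPoleAtInfinity (R : RatFunc ℂ) (hR : HasPoleAtInfinity R) :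
    R.denom.degree < R.num.degree := by
  by_contra h
  have h1 : R.num.natDegree ≤ R.denom.natDegree := natDegree_le_natDegree (not_lt.1 h)
  have hlc : R.denom.coeff R.denom.natDegree ≠ 0 := by
    rw [coeff_natDegree]; exact leadingCoeff_ne_zero.2 R.denom_ne_zero
  have h2 := (tendsto_eval_div_pow R.num h1).div (tendsto_eval_div_pow R.denom le_rfl) hlc
  have h3 : Tendsto (fun z => R.eval (RingHom.id ℂ) z) (cocompact ℂ)
      (𝓝 (R.num.coeff R.denom.natDegree / R.denom.coeff R.denom.natDegree)) := by
    refine h2.congr' ?_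
    filter_upwards [eventually_cocompact_ne 0] with z hz
    rw [Pi.div_apply, div_div_div_cancel_right₀ (pow_ne_zero _ hz), RatFunc.eval, eval₂_id,
      eval₂_id]
  exact h3.not_tendsto (disjoint_nhds_cocompact _) hR

lemma eq_C_mul_of_simple_roots {n : ℕ} {P : ℂ[X]} {v : Fin n → ℝ} (hv : Function.Injective v)
    (hP : P ≠ 0) (hroots : ∀ z : ℂ, P.eval z = 0 ↔ ∃ j, z = v j)
    (hsimple : ∀ j, P.rootMultiplicity (v j : ℂ) = 1) :
    P = C P.leadingCoeff * (rootPoly v).map Complex.ofRealHom := by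
  have hnodup : P.roots.Nodup := by
    rw [Multiset.nodup_iff_count_le_one]
    intro z
    rw [count_roots]
    by_cases hz : P.eval z = 0
    · obtain ⟨j, rfl⟩ := (hroots z).1 hz
      exact (hsimple j).le
    · rw [rootMultiplicity_eq_zero hz]
      exact zero_le_one
  have hroots' : P.roots = Finset.univ.val.map fun j => (v j : ℂ) := by
    refine (Multiset.Nodup.ext hnodup
      (Finset.univ.nodup.map (Complex.ofReal_injective.comp hv))).2 fun z => ?_
    rw [mem_roots hP, IsRoot, hroots, Multiset.mem_map]
    simp [eq_comm]
  conv_lhs => rw [(IsAlgClosed.splits P).eq_prod_roots, hroots', Multiset.map_map]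
  congr 1
  rw [rootPoly, Lagrange.nodal_eq, Polynomial.map_prod]
  simp [Finset.prod]

variable {g : ℕ} {a b : Fin (g + 1) → ℝ}

lemma num_sub_C_mul_denom_ne_zero {R : RatFunc ℂ} (h : R.denom.degree < R.num.degree) (t : ℂ) :
    (R.num - C t * R.denom) ≠ 0 ∧ (R.num - C t * R.denom).leadingCoeff = R.num.leadingCoeff := by
  have h1 : (C t * R.denom).degree < R.num.degree :=
    lt_of_le_of_lt (by rw [← smul_eq_C_mul]; exact degree_smul_le t R.denom) h
  have h2 := leadingCoeff_sub_of_degree_lt h1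
  refine ⟨fun h0 => ?_, h2⟩
  rw [h0, leadingCoeff_zero, eq_comm, leadingCoeff_eq_zero] at h2
  rw [h2, degree_zero] at h
  exact not_lt_bot h

lemma eval_num_sub_eq_zero_iff (R : RatFunc ℂ) (t z : ℂ) :
    (R.num - C t * R.denom).eval z = 0 ↔ sphereEval R z = (t : OnePoint ℂ) := by
  rw [sphereEval_eq_coe_iff, eval_sub, eval_mul, eval_C, sub_eq_zero]
  constructor
  · intro h
    have hD : R.denom.eval z ≠ 0 := fun h0 =>
      num_eval_ne_zero_of_denom_eval_eq_zero R h0 (by rw [h, h0, mul_zero])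
    exact ⟨hD, by rw [h, mul_div_cancel_right₀ _ hD]⟩
  · rintro ⟨hD, h⟩
    rwa [div_eq_iff hD] at h

/-- A Herglotz rational function with a pole at infinity is determined by its band set. -/
theorem eq_delta_of_bandPreimage (hab : IsGapData a b) (R : RatFunc ℂ) (hR : IsHerglotz R)
    (hinf : HasPoleAtInfinity R) (hband : bandPreimage R = gapSet a b) : R = delta a b := by
  have hdeg := degree_denom_lt_of_hasPoleAtInfinity R hinf
  have hmem : ∀ x : ℝ, x ∈ realGapSet a b ↔
      ∃ t ∈ Set.Icc (-2 : ℝ) 2, sphereEval R x = ((t : ℂ) : OnePoint ℂ) := by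
    intro x
    rw [← ofReal_mem_gapSet, ← hband]
    rfl
  have hreal : ∀ x : ℝ, (R.num.eval (x : ℂ) / R.denom.eval (x : ℂ)).im = 0 := by
    refine im_eval_eq_zero R (infinite_realGapSet hab) fun x hx => ?_
    obtain ⟨t, -, ht⟩ := (hmem x).1 hx
    rw [((sphereEval_eq_coe_iff R x t).1 ht).2, Complex.ofReal_im]
  have hloc : ∀ {t x₀ : ℝ}, sphereEval R x₀ = ((t : ℂ) : OnePoint ℂ) →
      (R.num - C (t : ℂ) * R.denom).rootMultiplicity (x₀ : ℂ) = 1 ∧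
      ∀ᶠ x : ℝ in 𝓝 x₀, ∃ s : ℝ, 0 < s ∧
        sphereEval R x = (((t + (x - x₀) * s : ℝ) : ℂ) : OnePoint ℂ) := by
    intro t x₀ h
    obtain ⟨h1, h2⟩ := herglotz_local R hR hreal (num_sub_C_mul_denom_ne_zero hdeg t).1
      ((eval_num_sub_eq_zero_iff R t x₀).2 h)
    refine ⟨h1, h2.mono ?_⟩
    rintro x ⟨hD, s, hs, hx⟩
    exact ⟨s, hs, (sphereEval_eq_coe_iff R x _).2 ⟨hD, hx⟩⟩
  have hval : ∀ {t x₀ : ℝ}, sphereEval R x₀ = ((t : ℂ) : OnePoint ℂ) →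
      Tendsto (fun x : ℝ => (R.num.eval (x : ℂ) / R.denom.eval (x : ℂ)).re) (𝓝 x₀) (𝓝 t) := by
    intro t x₀ h
    obtain ⟨hD, h⟩ := (sphereEval_eq_coe_iff R x₀ t).1 h
    have h1 : Tendsto (fun x : ℝ => R.num.eval (x : ℂ) / R.denom.eval (x : ℂ)) (𝓝 x₀)
        (𝓝 (R.num.eval (x₀ : ℂ) / R.denom.eval (x₀ : ℂ))) :=
      ((R.num.continuous.comp Complex.continuous_ofReal).tendsto x₀).div
      ((R.denom.continuous.comp Complex.continuous_ofReal).tendsto x₀) hD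
    rw [h] at h1
    exact (Complex.continuous_re.tendsto _).comp h1
  have hre : ∀ {t x : ℝ}, sphereEval R x = ((t : ℂ) : OnePoint ℂ) →
      (R.num.eval (x : ℂ) / R.denom.eval (x : ℂ)).re = t := by
    intro t x h
    rw [((sphereEval_eq_coe_iff R x t).1 h).2, Complex.ofReal_re]
  have hleft : ∀ z : ℂ, (R.num - C ((2 : ℝ) : ℂ) * R.denom).eval z = 0 ↔ ∃ j, z = a j := by
    intro z
    rw [eval_num_sub_eq_zero_iff]
    constructor
    · intro h
      have hz : z ∈ gapSet a b := by
        rw [← hband]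
        exact ⟨2, by norm_num, h⟩
      obtain ⟨x, hx, rfl⟩ := hz
      by_contra! hne
      -- If x is not some a j, then E continues to the right of x, where R is increasing and would
      -- exceed 2.
      have h1 := eventually_right_mem hx fun j hj => hne j (by rw [hj])
      have h2 := (hloc h).2.filter_mono (nhdsWithin_le_nhds (s := Set.Ioi x))
      obtain ⟨y, hy, ⟨s, hs, hys⟩, hxy⟩ := (h1.and (h2.and self_mem_nhdsWithin)).exists
      obtain ⟨t, ht, hyt⟩ := (hmem y).1 hy
      rw [hys, OnePoint.coe_eq_coe, Complex.ofReal_inj] at hyt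
      have := mul_pos (sub_pos.2 hxy) hs
      linarith [ht.2]
    · rintro ⟨j, rfl⟩
      obtain ⟨t, ht, hjt⟩ := (hmem _).1 (left_mem_realGapSet hab j)
      rcases ht.2.eq_or_lt with rfl | hlt
      · exact hjt
      · exfalso
        -- If R took a value t < 2 at a j, then R would stay in (t, 2) just to the right of a j,
        -- where there are no points of E.
        have h2 := (hloc hjt).2.filter_mono (nhdsWithin_le_nhds (s := Set.Ioi (a j)))
        have h3 := ((hval hjt).eventually_lt_const hlt).filter_mono
          (nhdsWithin_le_nhds (s := Set.Ioi (a j)))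
        obtain ⟨y, hy, ⟨s, hs, hys⟩, hy2, hxy⟩ := ((eventually_right_not_mem hab j).and
          (h2.and (h3.and self_mem_nhdsWithin))).exists
        rw [hre hys] at hy2
        have := mul_pos (sub_pos.2 hxy) hs
        exact hy ((hmem y).2 ⟨_, ⟨by linarith [ht.1], hy2.le⟩, hys⟩)
  have hright : ∀ z : ℂ, (R.num - C ((-2 : ℝ) : ℂ) * R.denom).eval z = 0 ↔ ∃ j, z = b j := by
    intro z
    rw [eval_num_sub_eq_zero_iff]
    constructor
    · intro h
      have hz : z ∈ gapSet a b := by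
        rw [← hband]
        exact ⟨-2, by norm_num, h⟩
      obtain ⟨x, hx, rfl⟩ := hz
      by_contra! hne
      have h1 := eventually_left_mem hx fun j hj => hne j (by rw [hj])
      have h2 := (hloc h).2.filter_mono (nhdsWithin_le_nhds (s := Set.Iio x))
      obtain ⟨y, hy, ⟨s, hs, hys⟩, hxy⟩ := (h1.and (h2.and self_mem_nhdsWithin)).exists
      obtain ⟨t, ht, hyt⟩ := (hmem y).1 hy
      rw [hys, OnePoint.coe_eq_coe, Complex.ofReal_inj] at hyt
      have := mul_neg_of_neg_of_pos (sub_neg.2 hxy) hs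
      linarith [ht.1]
    · rintro ⟨j, rfl⟩
      obtain ⟨t, ht, hjt⟩ := (hmem _).1 (right_mem_realGapSet hab j)
      rcases ht.1.eq_or_lt with rfl | hlt
      · exact hjt
      · exfalso
        have h2 := (hloc hjt).2.filter_mono (nhdsWithin_le_nhds (s := Set.Iio (b j)))
        have h3 := ((hval hjt).eventually_const_lt hlt).filter_mono
          (nhdsWithin_le_nhds (s := Set.Iio (b j)))
        obtain ⟨y, hy, ⟨s, hs, hys⟩, hy2, hxy⟩ := ((eventually_left_not_mem hab j).and
          (h2.and (h3.and self_mem_nhdsWithin))).exists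
        rw [hre hys] at hy2
        have := mul_neg_of_neg_of_pos (sub_neg.2 hxy) hs
        exact hy ((hmem y).2 ⟨_, ⟨hy2.le, by linarith [ht.2]⟩, hys⟩)
  obtain ⟨hne1, hlc1⟩ := num_sub_C_mul_denom_ne_zero hdeg ((2 : ℝ) : ℂ)
  obtain ⟨hne2, hlc2⟩ := num_sub_C_mul_denom_ne_zero hdeg ((-2 : ℝ) : ℂ)
  -- The degree of the denominator is smaller, so num - 2 denom and num + 2 denom share the leading
  -- coefficient k of num. They are k A and k B, and their sum and difference give num and denom.
  have h1 := eq_C_mul_of_simple_roots hab.left_injective hne1 hleft fun j =>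
    (hloc ((eval_num_sub_eq_zero_iff R _ _).1 ((hleft _).2 ⟨j, rfl⟩))).1
  have h2 := eq_C_mul_of_simple_roots hab.strictMono_right.injective hne2 hright fun j =>
    (hloc ((eval_num_sub_eq_zero_iff R _ _).1 ((hright _).2 ⟨j, rfl⟩))).1
  rw [hlc1] at h1
  rw [hlc2] at h2
  have hk : R.num.leadingCoeff ≠ 0 := by
    rw [← hlc1]; exact leadingCoeff_ne_zero.2 hne1
  set k := R.num.leadingCoeff
  have hN : C 4 * R.num = C k * (numP a b).map Complex.ofRealHom := by
    have e : (numP a b).map Complex.ofRealHom = C 2 * ((rootPoly b).map Complex.ofRealHom +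
        (rootPoly a).map Complex.ofRealHom) := by simp [numP]
    have e2 : C ((2 : ℝ) : ℂ) + C ((-2 : ℝ) : ℂ) = 0 := by rw [← C_add]; simp
    have e4 : (C 4 : ℂ[X]) = C 2 * 2 := by
      rw [show (2 : ℂ[X]) = C 2 from rfl, ← C_mul]; norm_num
    rw [e, e4]
    linear_combination C 2 * h1 + C 2 * h2 + C 2 * R.denom * e2
  have hD : C 4 * R.denom = C k * (poleP a b).map Complex.ofRealHom := by
    have e : (poleP a b).map Complex.ofRealHom = (rootPoly b).map Complex.ofRealHom -
        (rootPoly a).map Complex.ofRealHom := by simp [poleP]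
    have e4 : (C 4 : ℂ[X]) = C ((2 : ℝ) : ℂ) - C ((-2 : ℝ) : ℂ) := by
      rw [← C_sub]; norm_num
    rw [e, e4]
    linear_combination h2 - h1
  have hcross : R.num * (poleP a b).map Complex.ofRealHom =
      (numP a b).map Complex.ofRealHom * R.denom := by
    have hk' : (C k : ℂ[X]) ≠ 0 := C_ne_zero.2 hk
    refine mul_left_cancel₀ hk' ?_
    linear_combination R.denom * hN - R.num * hD
  rw [delta]
  conv_lhs => rw [← R.num_div_denom]
  rw [div_eq_div_iff (RatFunc.algebraMap_ne_zero R.denom_ne_zero) (RatFunc.algebraMap_ne_zero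
    ((Polynomial.map_ne_zero_iff Complex.ofRealHom.injective).2 (poleP_ne_zero hab))),
    ← map_mul, ← map_mul, hcross]

end Rigidity

/-! ### Identification of the Ahlfors function and the theorem -/

variable {g : ℕ} {a b : Fin (g + 1) → ℝ}

lemma norm_le_totalLength_div_four (hab : IsGapData a b) {f : ℂ → ℂ}
    (hf : IsCompetitor (gapSet a b) f) {l : ℂ}
    (hl : Tendsto (fun z => z * f z) (cocompact ℂ) (𝓝 l)) : ‖l‖ ≤ totalLength a b / 4 := by
  rw [← volume_realGapSet hab]
  exact norm_le_of_isCompetitor isCompact_realGapSet hf hl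

lemma isAhlfors_extremal (hab : IsGapData a b) : IsAhlfors (gapSet a b) (extremal a b) :=
  ⟨isCompetitor_extremal hab, totalLength a b / 4, by linarith [totalLength_pos hab],
    tendsto_mul_extremal hab, fun _ hf _ hl => norm_le_totalLength_div_four hab hf hl⟩

/-- Ψ and `extremal` are both competitors, so the bound Λ / 4 and the maximality of Ψ force equal
residues; `extremal_unique` then applies. -/
lemma IsAhlfors.eq_extremal (hab : IsGapData a b) {Ψ : ℂ → ℂ} (hΨ : IsAhlfors (gapSet a b) Ψ) :
    ∀ z ∈ (gapSet a b)ᶜ, Ψ z = extremal a b z := by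
  obtain ⟨hc, γ, hγ, hl, hmax⟩ := hΨ
  have h1 : γ ≤ totalLength a b / 4 := by
    have := norm_le_totalLength_div_four hab hc hl
    rwa [Complex.norm_real, Real.norm_of_nonneg hγ.le] at this
  have h2 : totalLength a b / 4 ≤ γ := by
    have := hmax _ (isCompetitor_extremal hab) _ (tendsto_mul_extremal hab)
    rwa [Complex.norm_real, Real.norm_of_nonneg (hγ.le.trans h1)] at this
  have hγe : γ = totalLength a b / 4 := le_antisymm h1 h2
  subst hγe
  exact extremal_unique isCompact_realGapSet hγ hc (isCompetitor_extremal hab) hl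
    (tendsto_mul_extremal hab) hmax

end FiniteGap

end

theorem lemma1 (g : ℕ) (a b : Fin (g + 1) → ℝ) (hab : FiniteGap.IsGapData a b) :
    (∃ Ψ : ℂ → ℂ, FiniteGap.IsAhlfors (FiniteGap.gapSet a b) Ψ) ∧
    ∀ Ψ : ℂ → ℂ, FiniteGap.IsAhlfors (FiniteGap.gapSet a b) Ψ →
      ∃ Δ : RatFunc ℂ,
        -- `Δ = Ψ + 1 / Ψ` on the complement of the gap set
        (∀ z ∈ (FiniteGap.gapSet a b)ᶜ,
          FiniteGap.joukowski (Ψ z) = FiniteGap.sphereEval Δ z) ∧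
        -- the form of `Δ`
        (∃ lam c : Fin (g + 1) → ℝ,
          (∀ j, 0 < lam j) ∧
          (∀ j : Fin g, c j.succ ∈ Set.Ioo (a j.succ) (b j.succ)) ∧
          Δ = RatFunc.C (lam 0 : ℂ) * RatFunc.X + RatFunc.C (c 0 : ℂ) +
            ∑ j : Fin g, RatFunc.C (lam j.succ : ℂ) /
              (RatFunc.C (c j.succ : ℂ) - RatFunc.X)) ∧
        -- `Δ` has the preimage property and is the only such rational function
        FiniteGap.bandPreimage Δ = FiniteGap.gapSet a b ∧
        FiniteGap.IsHerglotz Δ ∧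
        FiniteGap.HasPoleAtInfinity Δ ∧
        ∀ R : RatFunc ℂ, FiniteGap.IsHerglotz R → FiniteGap.HasPoleAtInfinity R →
          FiniteGap.bandPreimage R = FiniteGap.gapSet a b → R = Δ := by
  refine ⟨⟨_, FiniteGap.isAhlfors_extremal hab⟩, fun Ψ hΨ => ⟨FiniteGap.delta a b, ?_, ?_,
    FiniteGap.bandPreimage_delta hab, FiniteGap.isHerglotz_delta hab,
    FiniteGap.hasPoleAtInfinity_delta hab, FiniteGap.eq_delta_of_bandPreimage hab⟩⟩
  · intro z hz
    rw [hΨ.eq_extremal hab z hz]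
    exact FiniteGap.joukowski_extremal hab hz
  · obtain ⟨lam, c, h⟩ := FiniteGap.exists_isPoleData hab
    exact ⟨lam, c, h.pos, h.mem_gap, h.delta_eq hab⟩
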